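/- Let $\alpha\in(0,1)$. There is a two-sided binary subshift, that is, a closed shift-invariant set $X\subseteq\{0,1\}^{\mathbb Z}$ with the left shift $\sigma$, with the following properties. 1. $(X,\sigma)$ is strictly ergodic: $X$ is nonempty, it has no nonempty proper closed subset $F$ with $\sigma(F)\subseteq F$ (minimality), and it carries exactly one $\sigma$-invariant Borel probability measure (unique ergodicity). 2. $(X,\sigma)$ has topological entropy dimension $\alpha$, in the following sense. For a finite open cover $\mathcal U$ of $X$ let $\mathcal N(\mathcal U)$ be the least cardinality of a subcover, and let $\overline D(\sigma,\mathcal U)\in[0,\infty]$ be the critical value of the parameter $\beta>0$ above which $\limsup_{n\to\infty} n^{-\beta}\log\mathcal N\bigl(\bigvee_{i=0}^{n-1}\sigma^{-i}\mathcal U\bigr)$ is $0$ and below which it is $\infty$; let $\underline D(\sigma,\mathcal U)$ be defined in the same way with $\liminf$. Then $$\sup_{\mathcal U}\overline D(\sigma,\mathcal U)=\sup_{\mathcal U}\underline D(\sigma,\mathcal U)=\alpha,$$ where the suprema run over all finite open covers $\mathcal U$ of $X$. 3. In terms of words: if $\mathcal B_n(X)$ is the set of words of length $n$ that appear in points of $X$,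 then $$\lim_{n\to\infty}\frac{\log|\mathcal B_n(X)|}{n^{\beta}}=0\quad\text{for every }\beta>\alpha,\qquad \lim_{n\to\infty}\frac{\log|\mathcal B_n(X)|}{n^{\beta}}=\infty\quad\text{for every }0<\beta<\alpha.$$ -/

import Mathlib

open Set Filter Topology MeasureTheory
open scoped ENNReal

noncomputable section

namespace EntropyDim

/-! ### Critical growth exponents -/

/-- `limsup_n log (a n) / n ^ β`, as an element of `[0, ∞]`. -/
def upperRate (a : ℕ → ℕ) (β : ℝ) : ℝ≥0∞ :=
  limsup (fun n : ℕ => ENNReal.ofReal (Real.log (a n) / (n : ℝ) ^ β)) atTop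

/-- `liminf_n log (a n) / n ^ β`, as an element of `[0, ∞]`. -/
def lowerRate (a : ℕ → ℕ) (β : ℝ) : ℝ≥0∞ :=
  liminf (fun n : ℕ => ENNReal.ofReal (Real.log (a n) / (n : ℝ) ^ β)) atTop

/-- The critical value in `[0, ∞]` of a function `D` of a parameter `β > 0` that vanishes
above the critical value and is infinite below it: the infimum of the `β > 0` with `D β = 0`. -/
def criticalValue (D : ℝ → ℝ≥0∞) : ℝ≥0∞ :=
  ⨅ (β : ℝ) (_ : 0 < β) (_ : D β = 0), ENNReal.ofReal β

/-! ### Topological entropy dimension of a dynamical system -/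

section System

variable {X : Type*}

/-- The least cardinality of a subcover of `𝒰`. -/
def minSubcover (𝒰 : Set (Set X)) : ℕ :=
  sInf {k | ∃ F : Finset (Set X), (F : Set (Set X)) ⊆ 𝒰 ∧ ⋃₀ (F : Set (Set X)) = univ ∧
    F.card = k}

/-- The iterated cover `⋁_{i < n} T⁻ⁱ 𝒰`. -/
def iteratedCover (T : X → X) (𝒰 : Set (Set X)) (n : ℕ) : Set (Set X) :=
  {V | ∃ U : Fin n → Set X, (∀ i, U i ∈ 𝒰) ∧ V = ⋂ i : Fin n, T^[(i : ℕ)] ⁻¹' U i}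

/-- The upper entropy dimension of `T` relative to the cover `𝒰`. -/
def upperEntropyDimCover (T : X → X) (𝒰 : Set (Set X)) : ℝ≥0∞ :=
  criticalValue (upperRate fun n => minSubcover (iteratedCover T 𝒰 n))

/-- The lower entropy dimension of `T` relative to the cover `𝒰`. -/
def lowerEntropyDimCover (T : X → X) (𝒰 : Set (Set X)) : ℝ≥0∞ :=
  criticalValue (lowerRate fun n => minSubcover (iteratedCover T 𝒰 n))

variable [TopologicalSpace X]

/-- `𝒰` is a finite open cover of `X`. -/
def IsFiniteOpenCover (𝒰 : Set (Set X)) : Prop :=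
  𝒰.Finite ∧ (∀ U ∈ 𝒰, IsOpen U) ∧ ⋃₀ 𝒰 = univ

/-- The topological upper entropy dimension: supremum over all finite open covers. -/
def upperEntropyDim (T : X → X) : ℝ≥0∞ :=
  ⨆ (𝒰 : Set (Set X)) (_ : IsFiniteOpenCover 𝒰), upperEntropyDimCover T 𝒰

/-- The topological lower entropy dimension: supremum over all finite open covers. -/
def lowerEntropyDim (T : X → X) : ℝ≥0∞ :=
  ⨆ (𝒰 : Set (Set X)) (_ : IsFiniteOpenCover 𝒰), lowerEntropyDimCover T 𝒰

/-- `T` has topological entropy dimension `d`: the upper and the lower one both equal `d`. -/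
def HasEntropyDim (T : X → X) (d : ℝ≥0∞) : Prop :=
  upperEntropyDim T = d ∧ lowerEntropyDim T = d

/-! ### Strict ergodicity -/

/-- `X` is nonempty and has no proper nonempty closed subset that `T` maps into itself. -/
def IsMinimalSystem (T : X → X) : Prop :=
  Nonempty X ∧ ∀ F : Set X, IsClosed F → MapsTo T F F → F.Nonempty → F = univ

/-- There is exactly one `T`-invariant Borel probability measure. -/
def IsUniquelyErgodic [MeasurableSpace X] [BorelSpace X] (T : X → X) : Prop :=
  ∃! μ : Measure X, IsProbabilityMeasure μ ∧ MeasurePreserving T μ μ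

/-- Minimal and uniquely ergodic. -/
def IsStrictlyErgodic [MeasurableSpace X] [BorelSpace X] (T : X → X) : Prop :=
  IsMinimalSystem T ∧ IsUniquelyErgodic T

end System

/-! ### Two-sided subshifts -/

section Subshifts

open SymbolicDynamics.FullShift

variable {A : Type*} [TopologicalSpace A]

/-- The left shift `(σ x) k = x (1 + k)` on the points of a two-sided subshift. -/
def shiftMap (X : Subshift A ℤ) : X.carrier → X.carrier :=
  (X.mapsTo 1).restrict (shift (1 : ℤ)) X.carrier X.carrier

/-- The words of length `n` appearing in the points of `X`. -/
def words (X : Subshift A ℤ) (n : ℕ) : Set (Fin n → A) :=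
  {w | ∃ x ∈ X.carrier, ∃ i : ℤ, ∀ k : Fin n, w k = x (i + (k : ℕ))}

end Subshifts

end EntropyDim

end

/-! Put p = 1/α > 1, and write N_k, l_k for the number and the length of the words of level k. A
word of level k+1 is a string of words of level k in which only the blocks with index ⌊j^p⌋, j <
N_k², are free. The remaining blocks are the same in all words of level k+1: a fixed filler, then a
tail that lists all ordered pairs of words of level k. The subshift consists of the points that are
concatenations at every level.

Complexity: log N_{k+1} = N_k² log N_k, while l_{k+1}/l_k lies between N_k^{2p} and 3 N_k^{2p}, so
log N_k grows with exponent 1/p = α in l_k. The spacing ⌊j^p⌋ carries this exponent to all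
intermediate lengths: m consecutive blocks contain at most about m^α free ones, and an initial
string of m blocks has that many. If n is about m l_k, then log|B_n| is about m^α log N_k, that is,
of exponent α in n. See `ncard_words_le`, `pow_le_ncard_words` and the two bounds
`log_ncard_words_le`, `exists_mul_rpow_le_log_ncard_words`.

Minimality: any window is covered by two adjacent words of some level, and every pair occurs in
every word of the next level (`exists_pair`, `exists_window_eq`).

Unique ergodicity: since p > 1, the free blocks have proportion at most N_k^{-2(p-1)}, which tends
to 0. All words of level k+1 thus have nearly equal Birkhoff sums, and so do all long windows
(`isUniquelyErgodic_of_birkhoffSum`).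

Entropy dimension: covers are compared with words through cylinders (`hasEntropyDim_of_words`). -/

noncomputable section

namespace EntropyDim

/-! ### The hierarchical family of words -/

/-- The position of the `j`-th free block: the integer part of `j ^ p`. -/
def pos (p : ℝ) (j : ℕ) : ℕ := ⌊(j : ℝ) ^ p⌋₊

/-- The number of words of level `k`. -/
def numWords : ℕ → ℕ
  | 0 => 2
  | k + 1 => numWords k ^ numWords k ^ 2

/-- The number of words of level `k` that are concatenated to form a word of level `k + 1`. -/
def numBlocks (p : ℝ) (k : ℕ) : ℕ := pos p (numWords k ^ 2) + 2 * numWords k ^ 2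

/-- The length of the words of level `k`. -/
def wordLen (p : ℝ) : ℕ → ℕ
  | 0 => 1
  | k + 1 => numBlocks p k * wordLen p k

/-- The code of the `q`-th block of the word of level `k + 1` with code `c`. The blocks with index
`pos p j` are free and given by the digits of `c`, the last blocks run through all pairs of words
of level `k`. -/
def blockCode (p : ℝ) (k c q : ℕ) : ℕ :=
  open scoped Classical in
  if pos p (numWords k ^ 2) ≤ q then
    if (q - pos p (numWords k ^ 2)) % 2 = 0 then
      (q - pos p (numWords k ^ 2)) / 2 / numWords k % numWords k
    else (q - pos p (numWords k ^ 2)) / 2 % numWords k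
  else if q ∈ range (pos p) then
    c / numWords k ^ Function.invFun (pos p) q % numWords k
  else 0

/-- The word of level `k` with code `c`; only the letters with index below `wordLen p k` matter. -/
def word (p : ℝ) : ℕ → ℕ → ℕ → Fin 2
  | 0, c, _ => Fin.ofNat 2 c
  | k + 1, c, i => word p k (blockCode p k c (i / wordLen p k)) (i % wordLen p k)

lemma two_le_numWords (k : ℕ) : 2 ≤ numWords k := by
  induction k with
  | zero => simp [numWords]
  | succ k ih =>
    rw [numWords]
    calc 2 ≤ numWords k := ih
      _ ≤ _ := Nat.le_self_pow (by positivity) _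

lemma numWords_pos (k : ℕ) : 0 < numWords k := by have := two_le_numWords k; omega

lemma numBlocks_pos (p : ℝ) (k : ℕ) : 0 < numBlocks p k := by
  have := numWords_pos k
  unfold numBlocks; positivity

lemma wordLen_pos (p : ℝ) (k : ℕ) : 0 < wordLen p k := by
  induction k with
  | zero => simp [wordLen]
  | succ k ih => exact Nat.mul_pos (numBlocks_pos p k) ih

lemma two_le_numBlocks (p : ℝ) (k : ℕ) : 2 ≤ numBlocks p k := by
  have := numWords_pos k
  have : 0 < numWords k ^ 2 := by positivity
  unfold numBlocks; omega

lemma wordLen_strictMono (p : ℝ) : StrictMono (wordLen p) := by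
  refine strictMono_nat_of_lt_succ fun k => ?_
  have h1 := two_le_numBlocks p k
  have h2 := wordLen_pos p k
  rw [wordLen]; nlinarith

lemma numWords_strictMono : StrictMono numWords := by
  refine strictMono_nat_of_lt_succ fun k => ?_
  have h := two_le_numWords k
  rw [numWords]
  calc numWords k = numWords k ^ 1 := (pow_one _).symm
    _ < _ := Nat.pow_lt_pow_right (by omega) (by nlinarith)

/-! ### Spacing of the free blocks. -/

variable {p : ℝ}

/-- Superadditivity of t ↦ t^p. It makes the free blocks as sparse in a window starting anywhere as
in one starting at the origin. -/
lemma rpow_add_rpow_sub_le (hp : 1 ≤ p) {i j : ℕ} (h : i ≤ j) :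
    (i : ℝ) ^ p + ((j : ℝ) - i) ^ p ≤ (j : ℝ) ^ p := by
  have h' : (i : ℝ) ≤ j := by exact_mod_cast h
  have := Real.add_rpow_le_rpow_add (Nat.cast_nonneg (α := ℝ) i) (sub_nonneg.2 h') hp
  simpa using this

lemma pos_strictMono (hp : 1 ≤ p) : StrictMono (pos p) := by
  refine strictMono_nat_of_lt_succ fun j => ?_
  have h := rpow_add_rpow_sub_le hp (Nat.le_succ j)
  have h1 : ((j.succ : ℕ) : ℝ) - j = 1 := by push_cast; ring
  rw [h1, Real.one_rpow] at h
  have h2 : ⌊(j : ℝ) ^ p + 1⌋₊ ≤ ⌊((j.succ : ℕ) : ℝ) ^ p⌋₊ := Nat.floor_le_floor h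
  rw [Nat.floor_add_one (by positivity)] at h2
  exact h2

lemma le_pos (hp : 1 ≤ p) (j : ℕ) : j ≤ pos p j := (pos_strictMono hp).le_apply

/-- Free blocks in a window of `m` blocks have indices in an interval of length about
`m ^ (1 / p)`. -/
lemma lt_add_of_pos_lt (hp : 1 ≤ p) {i j m : ℕ} (h : pos p j < pos p i + m) :
    j < i + (⌊((m : ℝ) + 1) ^ (1 / p)⌋₊ + 1) := by
  rcases le_total j i with hji | hij
  · omega
  have hp0 : 0 < p := by linarith
  have h' : (i : ℝ) ≤ j := by exact_mod_cast hij
  have h1 := rpow_add_rpow_sub_le hp hij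
  have h2 : (j : ℝ) ^ p < pos p j + 1 := Nat.lt_floor_add_one _
  have h3 : (pos p i : ℝ) ≤ (i : ℝ) ^ p := Nat.floor_le (by positivity)
  have h4 : (pos p j : ℝ) < pos p i + m := by exact_mod_cast h
  have h5 : ((j : ℝ) - i) ^ p ≤ (m : ℝ) + 1 := by linarith
  have h6 : (j : ℝ) - i ≤ ((m : ℝ) + 1) ^ (1 / p) := by
    rw [one_div]
    exact (Real.le_rpow_inv_iff_of_pos (sub_nonneg.2 h') (by positivity) hp0).2 h5
  have h7 : j - i ≤ ⌊((m : ℝ) + 1) ^ (1 / p)⌋₊ := by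
    apply Nat.le_floor
    rw [Nat.cast_sub hij]; exact h6
  omega

/-! ### Digits of a code and the blocks that they fill. -/

lemma blockCode_lt (p : ℝ) (k c q : ℕ) : blockCode p k c q < numWords k := by
  have := numWords_pos k
  unfold blockCode
  split_ifs
  · exact Nat.mod_lt _ this
  · exact Nat.mod_lt _ this
  · exact Nat.mod_lt _ this
  · exact this

lemma blockCode_pos (hp : 1 ≤ p) {k c j : ℕ} (hj : j < numWords k ^ 2) :
    blockCode p k c (pos p j) = c / numWords k ^ j % numWords k := by
  have h : ¬ pos p (numWords k ^ 2) ≤ pos p j := by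
    rw [(pos_strictMono hp).le_iff_le]; omega
  unfold blockCode
  rw [if_neg h, if_pos ⟨j, rfl⟩, Function.leftInverse_invFun (pos_strictMono hp).injective]

/-- A block code depends only on the digit that is used in that block. -/
lemma blockCode_congr (hp : 1 ≤ p) {k c c' q : ℕ}
    (h : ∀ j < numWords k ^ 2, pos p j = q →
      c / numWords k ^ j % numWords k = c' / numWords k ^ j % numWords k) :
    blockCode p k c q = blockCode p k c' q := by
  by_cases hq : ∃ j < numWords k ^ 2, pos p j = q
  · obtain ⟨j, hj, rfl⟩ := hq
    rw [blockCode_pos hp hj, blockCode_pos hp hj, h j hj rfl]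
  · unfold blockCode
    split_ifs with h1 h2 h3
    · rfl
    · rfl
    · obtain ⟨j, rfl⟩ := h3
      exact (hq ⟨j, by rwa [not_le, (pos_strictMono hp).lt_iff_lt] at h1, rfl⟩).elim
    · rfl

lemma blockCode_pair_fst (p : ℝ) {k a b : ℕ} (c : ℕ) (ha : a < numWords k) (hb : b < numWords k) :
    blockCode p k c (pos p (numWords k ^ 2) + 2 * (a * numWords k + b)) = a := by
  have hN := numWords_pos k
  unfold blockCode
  rw [if_pos (by omega), if_pos (by omega)]
  rw [show (pos p (numWords k ^ 2) + 2 * (a * numWords k + b) - pos p (numWords k ^ 2)) / 2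
    = b + numWords k * a by rw [mul_comm a]; omega]
  rw [Nat.add_mul_div_left _ _ hN, Nat.div_eq_of_lt hb, zero_add, Nat.mod_eq_of_lt ha]

lemma blockCode_pair_snd (p : ℝ) {k a b : ℕ} (c : ℕ) (hb : b < numWords k) :
    blockCode p k c (pos p (numWords k ^ 2) + 2 * (a * numWords k + b) + 1) = b := by
  unfold blockCode
  rw [if_pos (by omega), if_neg (by omega)]
  rw [show (pos p (numWords k ^ 2) + 2 * (a * numWords k + b) + 1 - pos p (numWords k ^ 2)) / 2
    = b + numWords k * a by rw [mul_comm a]; omega]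
  rw [Nat.add_mul_mod_self_left, Nat.mod_eq_of_lt hb]

lemma pair_index_lt (p : ℝ) {k a b : ℕ} (ha : a < numWords k) (hb : b < numWords k) :
    pos p (numWords k ^ 2) + 2 * (a * numWords k + b) + 1 < numBlocks p k := by
  unfold numBlocks
  nlinarith

lemma word_succ_apply (p : ℝ) (k c : ℕ) {q t : ℕ} (ht : t < wordLen p k) :
    word p (k + 1) c (q * wordLen p k + t) = word p k (blockCode p k c q) t := by
  have h := wordLen_pos p k
  rw [word, mul_comm, Nat.mul_add_div h, Nat.mul_add_mod, Nat.div_eq_of_lt ht, add_zero,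
    Nat.mod_eq_of_lt ht]

lemma eq_of_forall_digit_eq {N : ℕ} {J : ℕ} {c c' : ℕ} (hc : c < N ^ J) (hc' : c' < N ^ J)
    (h : ∀ j < J, c / N ^ j % N = c' / N ^ j % N) : c = c' := by
  induction J generalizing c c' with
  | zero => simp at hc hc'; omega
  | succ J ih =>
    have h0 : c % N = c' % N := by simpa using h 0 (by omega)
    have h1 : c / N = c' / N := by
      apply ih
      · apply Nat.div_lt_of_lt_mul; rwa [pow_succ'] at hc
      · apply Nat.div_lt_of_lt_mul; rwa [pow_succ'] at hc'
      · intro j hj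
        have := h (j + 1) (by omega)
        rwa [pow_succ', ← Nat.div_div_eq_div_mul, ← Nat.div_div_eq_div_mul] at this
    rw [← Nat.div_add_mod c N, ← Nat.div_add_mod c' N, h0, h1]

/-- Cutting out K consecutive digits and putting them back in place does not change them. A window
meeting only these digits can therefore be encoded by one of N^K numbers instead of the full code.
-/
lemma digit_shift_mod {N j₀ K j c : ℕ} (hN : 0 < N) (h1 : j₀ ≤ j) (h2 : j < j₀ + K) :
    (c / N ^ j₀ % N ^ K * N ^ j₀) / N ^ j % N = c / N ^ j % N := by
  obtain ⟨i, rfl⟩ := Nat.exists_eq_add_of_le h1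
  obtain ⟨l, rfl⟩ : ∃ l, K = i + 1 + l := ⟨K - (i + 1), by omega⟩
  rw [pow_add N j₀ i, ← Nat.div_div_eq_div_mul, ← Nat.div_div_eq_div_mul,
    Nat.mul_div_cancel _ (by positivity), add_assoc, pow_add N i, Nat.mod_mul_right_div_self,
    pow_add N 1, pow_one, Nat.mod_mul_right_mod]

/-- Prefixes of words of level `k + 1` determine the digits of the code that they use. -/
lemma word_prefix_injective (hp : 1 ≤ p) {k m J : ℕ}
    (hk : ∀ c < numWords k, ∀ c' < numWords k,
      (∀ t < wordLen p k, word p k c t = word p k c' t) → c = c')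
    (hJ : J ≤ numWords k ^ 2) (hm : ∀ j < J, pos p j < m) {c c' : ℕ}
    (hc : c < numWords k ^ J) (hc' : c' < numWords k ^ J)
    (h : ∀ i < m * wordLen p k, word p (k + 1) c i = word p (k + 1) c' i) : c = c' := by
  refine eq_of_forall_digit_eq hc hc' fun j hj => ?_
  rw [← blockCode_pos hp (by omega), ← blockCode_pos hp (by omega)]
  refine hk _ (blockCode_lt ..) _ (blockCode_lt ..) fun t ht => ?_
  have := h (pos p j * wordLen p k + t) (by
    have := hm j hj
    calc pos p j * wordLen p k + t < (pos p j + 1) * wordLen p k := by rw [add_mul]; omega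
      _ ≤ _ := Nat.mul_le_mul_right _ this)
  rwa [word_succ_apply _ _ _ ht, word_succ_apply _ _ _ ht] at this

/-- Every digit of the code is displayed in some free block, and by induction the block reveals the
digit. -/
lemma word_injective (hp : 1 ≤ p) (k : ℕ) : ∀ c < numWords k, ∀ c' < numWords k,
    (∀ t < wordLen p k, word p k c t = word p k c' t) → c = c' := by
  induction k with
  | zero =>
    intro c hc c' hc' h
    have := h 0 (by simp [wordLen])
    simp only [numWords] at hc hc'
    simp only [word, Fin.ofNat, Fin.mk.injEq] at this
    omega
  | succ k ih =>
    intro c hc c' hc' h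
    refine word_prefix_injective hp (m := numBlocks p k) ih le_rfl (fun j hj => ?_) hc hc' h
    have := pos_strictMono hp hj
    unfold numBlocks; omega

/-- Two words of level `k + 1` differ only within the free blocks. -/
lemma card_word_ne_le (hp : 1 ≤ p) (k c c' : ℕ) :
    ((Finset.range (wordLen p (k + 1))).filter
      fun i => word p (k + 1) c i ≠ word p (k + 1) c' i).card ≤ numWords k ^ 2 * wordLen p k := by
  classical
  have h : ((Finset.range (wordLen p (k + 1))).filter
      fun i => word p (k + 1) c i ≠ word p (k + 1) c' i) ⊆
      (Finset.range (numWords k ^ 2) ×ˢ Finset.range (wordLen p k)).image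
        fun a => pos p a.1 * wordLen p k + a.2 := by
    intro i hi
    rw [Finset.mem_filter] at hi
    have : ∃ j < numWords k ^ 2, pos p j = i / wordLen p k := by
      by_contra! hq
      apply hi.2
      rw [word, word, blockCode_congr hp (c := c) (c' := c')]
      intro j hj hji
      exact (hq j hj hji).elim
    obtain ⟨j, hj, hji⟩ := this
    refine Finset.mem_image.2 ⟨(j, i % wordLen p k), ?_, ?_⟩
    · simp [hj, Nat.mod_lt _ (wordLen_pos p k)]
    · simp only [hji]; exact Nat.div_add_mod' _ _
  refine (Finset.card_le_card h).trans (Finset.card_image_le.trans ?_)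
  simp

/-! ### The subshift -/

open SymbolicDynamics.FullShift

/-- `x` is the concatenation of words of level `k` starting at the positions in
`r + ℤ * wordLen p k`. -/
def IsConcatAt (p : ℝ) (k : ℕ) (x : ℤ → Fin 2) (r : ℤ) : Prop :=
  ∀ j : ℤ, ∃ c < numWords k, ∀ t < wordLen p k, x (r + j * wordLen p k + t) = word p k c t

/-- The concatenations of words of level `k`. -/
def concats (p : ℝ) (k : ℕ) : Set (ℤ → Fin 2) := {x | ∃ r, IsConcatAt p k x r}

lemma IsConcatAt.add_mul {k : ℕ} {x : ℤ → Fin 2} {r : ℤ} (h : IsConcatAt p k x r) (i : ℤ) :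
    IsConcatAt p k x (r + i * wordLen p k) := by
  intro j
  obtain ⟨c, hc, hx⟩ := h (i + j)
  refine ⟨c, hc, fun t ht => ?_⟩
  rw [← hx t ht]; congr 1; ring

lemma exists_isConcatAt_mem_Ico {k : ℕ} {x : ℤ → Fin 2} (h : x ∈ concats p k) (a : ℤ) :
    ∃ r, a ≤ r ∧ r < a + wordLen p k ∧ IsConcatAt p k x r := by
  obtain ⟨r, hr⟩ := h
  have hl : (0 : ℤ) < wordLen p k := by exact_mod_cast wordLen_pos p k
  refine ⟨a + (r - a) % wordLen p k, ?_, ?_, ?_⟩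
  · have := Int.emod_nonneg (r - a) hl.ne'; omega
  · have := Int.emod_lt_of_pos (r - a) hl; omega
  · have h1 := Int.emod_add_mul_ediv (r - a) (wordLen p k)
    have : a + (r - a) % wordLen p k = r + (-((r - a) / wordLen p k)) * wordLen p k := by
      linear_combination h1
    rw [this]; exact hr.add_mul _

lemma IsConcatAt.shift {k : ℕ} {x : ℤ → Fin 2} {r : ℤ} (h : IsConcatAt p k x r) (g : ℤ) :
    IsConcatAt p k (SymbolicDynamics.FullShift.shift g x) (r - g) := by
  intro j
  obtain ⟨c, hc, hx⟩ := h j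
  refine ⟨c, hc, fun t ht => ?_⟩
  rw [← hx t ht, shift_apply]; congr 1; ring

lemma IsConcatAt.of_succ {k : ℕ} {x : ℤ → Fin 2} {r : ℤ} (h : IsConcatAt p (k + 1) x r) :
    IsConcatAt p k x r := by
  intro j
  have hL : (0 : ℤ) < numBlocks p k := by exact_mod_cast numBlocks_pos p k
  obtain ⟨c, -, hx⟩ := h (j / numBlocks p k)
  obtain ⟨q, hq⟩ := Int.eq_ofNat_of_zero_le (Int.emod_nonneg j hL.ne')
  have hqL : q < numBlocks p k := by
    have := Int.emod_lt_of_pos j hL; omega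
  refine ⟨blockCode p k c q, blockCode_lt .., fun t ht => ?_⟩
  rw [← word_succ_apply _ _ _ ht, ← hx]
  · congr 1
    have := Int.emod_add_mul_ediv j (numBlocks p k)
    rw [wordLen]; push_cast
    rw [hq] at this
    linear_combination (-(wordLen p k : ℤ)) * this
  · rw [wordLen]
    calc q * wordLen p k + t < (q + 1) * wordLen p k := by rw [_root_.add_mul]; omega
      _ ≤ _ := Nat.mul_le_mul_right _ hqL

lemma concats_succ_subset (p : ℝ) (k : ℕ) : concats p (k + 1) ⊆ concats p k :=
  fun _ ⟨r, hr⟩ => ⟨r, hr.of_succ⟩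

/-- The offset matters only modulo the word length, so the union over offsets can be taken finite.
-/
lemma isClosed_concats (p : ℝ) (k : ℕ) : IsClosed (concats p k) := by
  have h : concats p k = ⋃ r ∈ Finset.Ico (0 : ℤ) (0 + wordLen p k), ⋂ j : ℤ,
      ⋃ c ∈ Finset.range (numWords k), ⋂ t : ℕ, ⋂ _ : t < wordLen p k,
        {x : ℤ → Fin 2 | x (r + j * wordLen p k + t) = word p k c t} := by
    ext x
    simp only [mem_iUnion, mem_iInter, Finset.mem_Ico, Finset.mem_range, mem_ofPred_eq,
      exists_prop]
    constructor
    · intro hx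
      obtain ⟨r, h0, h1, h2⟩ := exists_isConcatAt_mem_Ico hx 0
      exact ⟨r, ⟨h0, h1⟩, h2⟩
    · rintro ⟨r, -, h⟩
      exact ⟨r, h⟩
  rw [h]
  refine Set.Finite.isClosed_biUnion (Finset.finite_toSet _) fun r _ => isClosed_iInter fun j =>
    Set.Finite.isClosed_biUnion (Finset.finite_toSet _) fun c _ => isClosed_iInter fun t =>
    isClosed_iInter fun _ => isClosed_eq (continuous_apply _) continuous_const

lemma concats_nonempty (p : ℝ) (k : ℕ) : (concats p k).Nonempty := by
  refine ⟨fun i => word p k 0 (i % wordLen p k).toNat, 0, fun j => ⟨0, numWords_pos k,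
    fun t ht => ?_⟩⟩
  have : (0 + j * (wordLen p k : ℤ) + t) % wordLen p k = t := by
    rw [show 0 + j * (wordLen p k : ℤ) + t = t + j * (wordLen p k : ℤ) by ring,
      Int.add_mul_emod_self_right, Int.emod_eq_of_lt (by omega) (by omega)]
  simp only [this, Int.toNat_natCast]

/-- The subshift of the points that are concatenations of words of every level. -/
def hierSubshift (p : ℝ) : Subshift (Fin 2) ℤ where
  carrier := ⋂ k, concats p k
  isClosed := isClosed_iInter (isClosed_concats p)
  mapsTo g x hx := by
    rw [mem_iInter] at hx ⊢
    intro k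
    obtain ⟨r, hr⟩ := hx k
    exact ⟨_, hr.shift g⟩

lemma mem_hierSubshift {x : ℤ → Fin 2} : x ∈ (hierSubshift p).carrier ↔ ∀ k, x ∈ concats p k :=
  mem_iInter

lemma hierSubshift_nonempty (p : ℝ) : (hierSubshift p).carrier.Nonempty :=
  IsCompact.nonempty_iInter_of_sequence_nonempty_isCompact_isClosed _ (concats_succ_subset p)
    (concats_nonempty p) (isClosed_concats p 0).isCompact (isClosed_concats p)

instance (X : Subshift (Fin 2) ℤ) : CompactSpace X.carrier :=
  isCompact_iff_compactSpace.1 X.isClosed.isCompact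

/-- Each pair of words of level `k` appears in every word of level `k + 1`. -/
lemma exists_pair {k a b : ℕ} (ha : a < numWords k) (hb : b < numWords k) {x : ℤ → Fin 2}
    (hx : x ∈ concats p (k + 1)) (N : ℤ) :
    ∃ i, N ≤ i ∧ (∀ t < wordLen p k, x (i + t) = word p k a t) ∧
      ∀ t < wordLen p k, x (i + wordLen p k + t) = word p k b t := by
  obtain ⟨r, hr, -, h⟩ := exists_isConcatAt_mem_Ico hx N
  obtain ⟨c, -, hc⟩ := h 0
  obtain ⟨q, hqL, hqa, hqb⟩ : ∃ q, q + 1 < numBlocks p k ∧ blockCode p k c q = a ∧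
      blockCode p k c (q + 1) = b :=
    ⟨_, pair_index_lt p ha hb, blockCode_pair_fst p c ha hb, blockCode_pair_snd p c hb⟩
  have hlt : ∀ t < wordLen p k, (q + 1) * wordLen p k + t < wordLen p (k + 1) := by
    intro t ht
    rw [wordLen]
    calc (q + 1) * wordLen p k + t < (q + 1 + 1) * wordLen p k := by
            rw [add_mul (q + 1)]; omega
      _ ≤ _ := Nat.mul_le_mul_right _ hqL
  refine ⟨r + q * wordLen p k, le_add_of_le_of_nonneg hr (by positivity),
    fun t ht => ?_, fun t ht => ?_⟩
  · rw [← hqa, ← word_succ_apply _ _ _ ht, ← hc]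
    · congr 1; push_cast; ring
    · have := hlt t ht; rw [add_mul q] at this; omega
  · rw [← hqb, ← word_succ_apply _ _ _ ht, ← hc]
    · congr 1; push_cast; ring
    · exact hlt t ht

lemma iterate_shiftMap_apply (X : Subshift (Fin 2) ℤ) (n : ℕ) (x : X.carrier) (i : ℤ) :
    ((shiftMap X)^[n] x : ℤ → Fin 2) i = (x : ℤ → Fin 2) (n + i) := by
  induction n generalizing x with
  | zero => simp
  | succ n ih =>
    rw [Function.iterate_succ_apply, ih]
    change shift (1 : ℤ) (x : ℤ → Fin 2) _ = _
    rw [shift_apply]; push_cast; ring_nf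

lemma continuous_shiftMap (X : Subshift (Fin 2) ℤ) : Continuous (shiftMap X) :=
  (continuous_shift (1 : ℤ)).restrict _

/-- Points that agree on a large window are close. -/
lemma exists_window_subset {X : Subshift (Fin 2) ℤ} {x : X.carrier} {U : Set X.carrier}
    (hU : U ∈ 𝓝 x) : ∃ M : ℕ, ∀ y : X.carrier,
      (∀ i : ℤ, |i| ≤ M → (y : ℤ → Fin 2) i = (x : ℤ → Fin 2) i) → y ∈ U := by
  rw [nhds_subtype_eq_comap, nhds_pi, Filter.mem_comap] at hU
  obtain ⟨V, hV, hVU⟩ := hU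
  obtain ⟨I, hI, t, ht, htV⟩ := Filter.mem_pi.1 hV
  obtain ⟨M, hM⟩ : ∃ M : ℕ, ∀ i ∈ I, |i| ≤ M := by
    obtain ⟨B, hB⟩ := (hI.image fun i : ℤ => |i|).bddAbove
    exact ⟨B.toNat, fun i hi => (hB (mem_image_of_mem _ hi)).trans (Int.self_le_toNat B)⟩
  refine ⟨M, fun y hy => hVU (htV fun i hi => ?_)⟩
  change (y : ℤ → Fin 2) i ∈ t i
  rw [hy i (hM i hi)]
  exact mem_of_mem_nhds (ht i)

/-- Each window of a point of the subshift reappears in every other point, arbitrarily far to the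
right. -/
lemma exists_window_eq {x y : ℤ → Fin 2} (hx : x ∈ (hierSubshift p).carrier)
    (hy : y ∈ (hierSubshift p).carrier) (M : ℕ) :
    ∃ n : ℕ, ∀ i : ℤ, |i| ≤ M → x (n + i) = y i := by
  obtain ⟨k, hk⟩ : ∃ k, 2 * M + 1 ≤ wordLen p k :=
    ⟨_, (wordLen_strictMono p).le_apply⟩
  -- This range for r places [-M, M] inside the two words that start at r and r + `wordLen p k`.
  obtain ⟨r, h0, h1, hr⟩ := exists_isConcatAt_mem_Ico (mem_hierSubshift.1 hy k)
    (-M - wordLen p k)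
  obtain ⟨a, ha, ha'⟩ := hr 0
  obtain ⟨b, hb, hb'⟩ := hr 1
  obtain ⟨i₀, hi₀, h2, h3⟩ := exists_pair ha hb (mem_hierSubshift.1 hx (k + 1)) r
  refine ⟨(i₀ - r).toNat, fun i hi => ?_⟩
  rw [abs_le] at hi
  rw [Int.toNat_of_nonneg (by omega)]
  by_cases hlt : i - r < wordLen p k
  · obtain ⟨t, ht⟩ := Int.eq_ofNat_of_zero_le (show 0 ≤ i - r by omega)
    have e1 := h2 t (by omega)
    have e2 := ha' t (by omega)
    rw [show i₀ - r + i = i₀ + t by omega, e1, ← e2]; congr 1; omega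
  · obtain ⟨t, ht⟩ := Int.eq_ofNat_of_zero_le (show 0 ≤ i - r - wordLen p k by omega)
    have e1 := h3 t (by omega)
    have e2 := hb' t (by omega)
    rw [show i₀ - r + i = i₀ + wordLen p k + t by omega, e1, ← e2]; congr 1; omega

/-- Every forward orbit is dense, because windows recur to the right; forward invariance of F is
thus enough. -/
theorem isMinimalSystem_hierSubshift (p : ℝ) : IsMinimalSystem (shiftMap (hierSubshift p)) := by
  refine ⟨(hierSubshift_nonempty p).to_subtype, fun F hF hT ⟨x, hx⟩ => ?_⟩
  refine eq_univ_of_forall fun y => ?_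
  rw [← hF.closure_eq, mem_closure_iff_nhds]
  intro U hU
  obtain ⟨M, hM⟩ := exists_window_subset hU
  obtain ⟨n, hn⟩ := exists_window_eq x.2 y.2 M
  refine ⟨(shiftMap (hierSubshift p))^[n] x, hM _ fun i hi => ?_, hT.iterate n hx⟩
  rw [iterate_shiftMap_apply, hn i hi]

/-! ### Counting words -/

lemma exists_wordLen_le_lt (p : ℝ) {n : ℕ} (hn : 1 ≤ n) :
    ∃ k, wordLen p k ≤ n ∧ n < wordLen p (k + 1) := by
  classical
  have h : ∃ k, n < wordLen p k :=
    ⟨n + 1, (Nat.lt_succ_self n).trans_le (wordLen_strictMono p).le_apply⟩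
  -- The least index is not 0, since words of level 0 have length 1 ≤ n.
  obtain ⟨k, hk⟩ : ∃ k, Nat.find h = k + 1 := by
    refine Nat.exists_eq_succ_of_ne_zero fun h0 => ?_
    have := Nat.find_spec h
    rw [h0, wordLen] at this
    omega
  refine ⟨k, not_lt.1 (Nat.find_min h (by omega)), ?_⟩
  rw [← hk]; exact Nat.find_spec h

/-- Words of the subshift arising as prefixes of words of level `k + 1`. -/
lemma pow_le_ncard_words (hp : 1 ≤ p) {k m J n : ℕ} (hJ : J ≤ numWords k ^ 2)
    (hm : ∀ j < J, pos p j < m) (hmL : m ≤ numBlocks p k) (hn : m * wordLen p k ≤ n) :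
    numWords k ^ J ≤ (words (hierSubshift p) n).ncard := by
  obtain ⟨x, hx⟩ := hierSubshift_nonempty p
  have hle : numWords k ^ J ≤ numWords (k + 1) := by
    rw [numWords]; exact Nat.pow_le_pow_right (numWords_pos k) hJ
  -- A single point x suffices: the pair (c, c) occurs in each word of level k + 2.
  have h : ∀ c < numWords k ^ J, ∃ i : ℤ, ∀ t < wordLen p (k + 1),
      x (i + t) = word p (k + 1) c t := fun c hc => by
    obtain ⟨i, -, hi, -⟩ := exists_pair (hc.trans_le hle) (hc.trans_le hle)
      (mem_hierSubshift.1 hx (k + 2)) 0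
    exact ⟨i, hi⟩
  choose! i hi using h
  have hinj : InjOn (fun c (t : Fin n) => x (i c + (t : ℕ))) (Iio (numWords k ^ J)) := by
    intro c hc c' hc' hcc
    refine word_prefix_injective hp (word_injective hp k) hJ hm hc hc' fun t ht => ?_
    have htl : t < wordLen p (k + 1) := ht.trans_le (Nat.mul_le_mul_right _ hmL)
    rw [← hi c hc t htl, ← hi c' hc' t htl]
    exact congrFun hcc ⟨t, ht.trans_le hn⟩
  calc numWords k ^ J = (Iio (numWords k ^ J)).ncard := by simp [ncard_eq_toFinset_card']
    _ = _ := hinj.ncard_image.symm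
    _ ≤ _ := ncard_le_ncard (by
        rintro _ ⟨c, -, rfl⟩; exact ⟨x, hx, i c, fun t => rfl⟩) (toFinite _)

/-- A word of level `k + 1`, read along a window of blocks, is determined by the digits that the
window uses. -/
lemma word_congr_window (hp : 1 ≤ p) {k a m j₀ : ℕ} (hj₀ : a ≤ pos p j₀)
    (hmin : ∀ j, a ≤ pos p j → j₀ ≤ j) (c : ℕ) {u : ℕ} (hu : a ≤ u / wordLen p k)
    (hu' : u / wordLen p k < a + m) :
    word p (k + 1) c u = word p (k + 1) (c / numWords k ^ j₀ %
      numWords k ^ (⌊((m : ℝ) + 1) ^ (1 / p)⌋₊ + 1) * numWords k ^ j₀) u := by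
  rw [word, word, blockCode_congr hp]
  rintro j - hj
  rw [digit_shift_mod (numWords_pos k)]
  · exact hmin j (by omega)
  -- The used index satisfies `pos p j < a + m ≤ pos p j₀ + m`.
  · exact lt_add_of_pos_lt hp (by omega)

/-- Words of length at most `wordLen p (k + 1)` are read off at most two words of level `k + 1`. -/
lemma ncard_words_le (hp : 1 ≤ p) {k n : ℕ} (hn : n ≤ wordLen p (k + 1)) :
    (words (hierSubshift p) n).ncard ≤ wordLen p (k + 1) ^ 2 *
      numWords k ^ (2 * (⌊(((n / wordLen p k : ℕ) : ℝ) + 3) ^ (1 / p)⌋₊ + 1)) := by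
  classical
  set ℓ := wordLen p (k + 1) with hℓ
  set l := wordLen p k with hl
  -- An unaligned window of n letters meets at most n / l + 2 blocks of length l.
  set m := n / l + 2 with hm
  have hmK : (((n / l : ℕ) : ℝ) + 3) = (m : ℝ) + 1 := by rw [hm]; push_cast; ring
  rw [hmK]
  set K := ⌊((m : ℝ) + 1) ^ (1 / p)⌋₊ + 1 with hK
  have hN := numWords_pos k
  have hlpos : 0 < l := wordLen_pos p k
  -- The data are the offset in the first word, the first free index from there on, and the K digits
  -- used in each of the two words; in the second word these start at digit 0.
  let G : ℕ × ℕ × ℕ × ℕ → Fin n → Fin 2 := fun a t =>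
    if a.1 + t < ℓ then word p (k + 1) (a.2.2.1 * numWords k ^ a.2.1) (a.1 + t)
    else word p (k + 1) a.2.2.2 (a.1 + t - ℓ)
  let S : Finset (ℕ × ℕ × ℕ × ℕ) := Finset.range ℓ ×ˢ Finset.range ℓ ×ˢ
    Finset.range (numWords k ^ K) ×ˢ Finset.range (numWords k ^ K)
  have hsub : words (hierSubshift p) n ⊆ (S.image G : Finset (Fin n → Fin 2)) := by
    rintro w ⟨x, hx, i, hw⟩
    obtain ⟨r, h0, h1, hr⟩ := exists_isConcatAt_mem_Ico (mem_hierSubshift.1 hx (k + 1))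
      (i - ℓ + 1)
    obtain ⟨c, -, hc⟩ := hr 0
    obtain ⟨d, -, hd⟩ := hr 1
    obtain ⟨v, hv⟩ := Int.eq_ofNat_of_zero_le (show 0 ≤ i - r by omega)
    have hvℓ : v < ℓ := by omega
    have hex : ∃ j, v / l ≤ pos p j := ⟨_, le_pos hp _⟩
    have hmin : ∀ j, v / l ≤ pos p j → Nat.find hex ≤ j := fun j hj => Nat.find_min' hex hj
    rw [Finset.coe_image]
    refine ⟨(v, Nat.find hex, c / numWords k ^ Nat.find hex % numWords k ^ K,
      d % numWords k ^ K), ?_, ?_⟩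
    · have h2 : Nat.find hex < ℓ :=
        ((hmin _ (le_pos hp _)).trans (Nat.div_le_self _ _)).trans_lt hvℓ
      have h3 : 0 < numWords k ^ K := by positivity
      simp [S, hvℓ, h2, Nat.mod_lt _ h3]
    · ext1 t
      have ht := t.2
      have hdiv : ((t : ℕ) : ℕ) / l ≤ n / l := Nat.div_le_div_right ht.le
      rw [hw t]
      by_cases hlt : v + t < ℓ
      · have hu : (v + t) / l < v / l + m := by
          have h4 : (v + t) / l ≤ v / l + t / l + 1 := by
            rw [Nat.add_div hlpos]; split_ifs <;> omega
          omega
        simp only [G, if_pos hlt]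
        rw [← word_congr_window hp (Nat.find_spec hex) hmin c
          (Nat.div_le_div_right (by omega)) hu, ← hc _ hlt]
        congr 1; push_cast; omega
      · have hu : (v + t - ℓ) / l < 0 + m := by
          have := Nat.div_le_div_right (c := l) (show v + t - ℓ ≤ n by omega)
          omega
        simp only [G, if_neg hlt]
        have := word_congr_window hp (a := 0) (j₀ := 0) (Nat.zero_le _)
          (fun j _ => Nat.zero_le j) d (Nat.zero_le _) hu
        rw [pow_zero, Nat.div_one, mul_one] at this
        rw [← this, ← hd _ (by omega)]
        congr 1; omega
  calc (words (hierSubshift p) n).ncard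
      ≤ ((S.image G : Finset (Fin n → Fin 2)) : Set (Fin n → Fin 2)).ncard :=
        ncard_le_ncard hsub (toFinite _)
    _ = (S.image G).card := ncard_coe_finset _
    _ ≤ S.card := Finset.card_image_le
    _ = _ := by simp [S]; ring

/-! ### Growth of the number of words -/

lemma log_numWords_succ (k : ℕ) :
    Real.log (numWords (k + 1)) = (numWords k : ℝ) ^ 2 * Real.log (numWords k) := by
  rw [numWords, Nat.cast_pow, Real.log_pow, Nat.cast_pow]

lemma log_numWords_nonneg (k : ℕ) : 0 ≤ Real.log (numWords k) := Real.log_natCast_nonneg _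

lemma sq_rpow_le_numBlocks (p : ℝ) (k : ℕ) :
    ((numWords k : ℝ) ^ 2) ^ p ≤ numBlocks p k := by
  have h1 : 1 ≤ numWords k ^ 2 := Nat.one_le_pow _ _ (numWords_pos k)
  have h := (Nat.lt_floor_add_one (((numWords k ^ 2 : ℕ) : ℝ) ^ p)).le
  have h2 : pos p (numWords k ^ 2) + 1 ≤ numBlocks p k := by unfold numBlocks; omega
  have h3 : ((pos p (numWords k ^ 2) : ℝ) + 1) ≤ numBlocks p k := by exact_mod_cast h2
  push_cast at h
  refine h.trans (le_trans ?_ h3)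
  simp [pos]

/-- The tail of pairs costs 2 N_k² ≤ 2 N_k^{2p} blocks: taking N_k² free blocks keeps it from
dominating the length. -/
lemma numBlocks_le (hp : 1 ≤ p) (k : ℕ) :
    (numBlocks p k : ℝ) ≤ 3 * ((numWords k : ℝ) ^ 2) ^ p := by
  have h1 : (1 : ℝ) ≤ (numWords k : ℝ) ^ 2 := by
    exact_mod_cast Nat.one_le_pow _ _ (numWords_pos k)
  have h2 : (pos p (numWords k ^ 2) : ℝ) ≤ ((numWords k : ℝ) ^ 2) ^ p := by
    have := Nat.floor_le (a := ((numWords k ^ 2 : ℕ) : ℝ) ^ p) (by positivity)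
    push_cast at this
    simpa [pos] using this
  have h3 : (numWords k : ℝ) ^ 2 ≤ ((numWords k : ℝ) ^ 2) ^ p :=
    Real.self_le_rpow_of_one_le h1 hp
  unfold numBlocks; push_cast; linarith

/-- From level k to k + 1 the left side is multiplied by N_k², the right side by `numBlocks p k ^ (1
/ p)`, which is at least N_k². -/
lemma log_numWords_le (hp : 1 ≤ p) (k : ℕ) :
    Real.log (numWords k) ≤ (wordLen p k : ℝ) ^ (1 / p) := by
  have hp0 : 0 < p := by linarith
  induction k with
  | zero =>
    simp only [numWords, wordLen, Nat.cast_one, Real.one_rpow]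
    have := Real.log_two_lt_d9; push_cast; linarith
  | succ k ih =>
    rw [log_numWords_succ, wordLen, Nat.cast_mul, Real.mul_rpow (by positivity) (by positivity)]
    gcongr
    rw [one_div]
    exact (Real.le_rpow_inv_iff_of_pos (by positivity) (by positivity) hp0).2
      (sq_rpow_le_numBlocks p k)

/-- The upper bound for the complexity of the subshift. -/
lemma log_ncard_words_le (hp : 1 ≤ p) {n : ℕ} (hn : 1 ≤ n) :
    Real.log (words (hierSubshift p) n).ncard ≤ (6 * p + 14) * (n : ℝ) ^ (1 / p) := by
  have hp0 : 0 < p := by linarith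
  have hα0 : 0 < 1 / p := by positivity
  have hα1 : 1 / p ≤ 1 := by rw [div_le_one hp0]; exact hp
  obtain ⟨k, hk, hk'⟩ := exists_wordLen_le_lt p hn
  have hl : (1 : ℝ) ≤ wordLen p k := by exact_mod_cast wordLen_pos p k
  have hkn : (wordLen p k : ℝ) ≤ n := by exact_mod_cast hk
  have hn1 : (1 : ℝ) ≤ n := hl.trans hkn
  set x := (n : ℝ) ^ (1 / p) with hx
  have hx1 : 1 ≤ x := Real.one_le_rpow hn1 hα0.le
  have ha := log_numWords_le hp k
  have hax : (wordLen p k : ℝ) ^ (1 / p) ≤ x := Real.rpow_le_rpow (by positivity) hkn hα0.le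
  have hN1 : (1 : ℝ) ≤ numWords k := by exact_mod_cast numWords_pos k
  have hlogl : Real.log (wordLen p k) ≤ p * x := by
    calc Real.log (wordLen p k) ≤ Real.log n := Real.log_le_log (by positivity) hkn
      _ ≤ (n : ℝ) ^ (1 / p) / (1 / p) := Real.log_le_rpow_div (by positivity) hα0
      _ = p * x := by rw [hx]; field_simp
  have hlogL : Real.log (numBlocks p k) ≤ 2 * x + 2 * p * x := by
    have hL : (0 : ℝ) < numBlocks p k := by exact_mod_cast numBlocks_pos p k
    calc Real.log (numBlocks p k) ≤ Real.log (3 * ((numWords k : ℝ) ^ 2) ^ p) :=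
          Real.log_le_log hL (numBlocks_le hp k)
      _ = Real.log 3 + p * (2 * Real.log (numWords k)) := by
          rw [Real.log_mul (by norm_num) (by positivity), Real.log_rpow (by positivity),
            Real.log_pow]
          push_cast; ring
      _ ≤ 2 * x + p * (2 * x) := by
          have h3 : Real.log 3 ≤ 2 := by
            have := Real.log_le_sub_one_of_pos (show (0 : ℝ) < 3 by norm_num); linarith
          gcongr
          · linarith
          · linarith
      _ = _ := by ring
  set K := ⌊(((n / wordLen p k : ℕ) : ℝ) + 3) ^ (1 / p)⌋₊ + 1 with hK
  have hKa : K * Real.log (numWords k) ≤ 5 * x := by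
    set y := (n : ℝ) / wordLen p k with hy
    have hy1 : 1 ≤ y := by rw [hy, one_le_div (by positivity)]; exact hkn
    have h1 : ((n / wordLen p k : ℕ) : ℝ) ≤ y := Nat.cast_div_le
    have hyα : 1 ≤ y ^ (1 / p) := Real.one_le_rpow hy1 hα0.le
    have h2 : (K : ℝ) ≤ 5 * y ^ (1 / p) := by
      calc (K : ℝ) ≤ (((n / wordLen p k : ℕ) : ℝ) + 3) ^ (1 / p) + 1 := by
            rw [hK]; push_cast; gcongr; exact Nat.floor_le (by positivity)
        _ ≤ (4 * y) ^ (1 / p) + 1 := by gcongr; linarith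
        _ = 4 ^ (1 / p) * y ^ (1 / p) + 1 := by rw [Real.mul_rpow (by norm_num) (by positivity)]
        _ ≤ 4 * y ^ (1 / p) + y ^ (1 / p) := by
            gcongr
            exact Real.rpow_le_self_of_one_le (by norm_num) hα1
        _ = _ := by ring
    calc K * Real.log (numWords k) ≤ 5 * y ^ (1 / p) * (wordLen p k : ℝ) ^ (1 / p) :=
          mul_le_mul h2 ha (log_numWords_nonneg k) (by positivity)
      _ = 5 * (y * wordLen p k) ^ (1 / p) := by
          rw [mul_assoc, Real.mul_rpow (by positivity) (by positivity)]
      _ = 5 * x := by rw [hy, div_mul_cancel₀ _ (by positivity)]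
  have hcard := ncard_words_le hp hk'.le
  rw [← hK] at hcard
  -- With the convention log 0 = 0, the bound needs no proof that words exist.
  rcases Nat.eq_zero_or_pos (words (hierSubshift p) n).ncard with h0 | h0
  · rw [h0]; simp only [Nat.cast_zero, Real.log_zero]; positivity
  calc Real.log (words (hierSubshift p) n).ncard
      ≤ Real.log ((wordLen p (k + 1) : ℝ) ^ 2 * (numWords k : ℝ) ^ (2 * K)) :=
        Real.log_le_log (by exact_mod_cast h0) (by exact_mod_cast hcard)
    _ = 2 * (Real.log (numBlocks p k) + Real.log (wordLen p k))
        + 2 * (K * Real.log (numWords k)) := by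
        have hL : (numBlocks p k : ℝ) ≠ 0 := by exact_mod_cast (numBlocks_pos p k).ne'
        have hl0 : (wordLen p k : ℝ) ≠ 0 := by positivity
        rw [wordLen, Real.log_mul (by push_cast; positivity) (by positivity), Real.log_pow,
          Real.log_pow, Nat.cast_mul, Real.log_mul hL hl0]
        push_cast; ring
    _ ≤ 2 * ((2 * x + 2 * p * x) + p * x) + 2 * (5 * x) := by gcongr
    _ = _ := by ring

lemma tendsto_sq_numWords_rpow {δ : ℝ} (hδ : 0 < δ) :
    Tendsto (fun k => ((numWords k : ℝ) ^ 2) ^ δ) atTop atTop := by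
  have h : Tendsto (fun k => (numWords k : ℝ)) atTop atTop :=
    tendsto_natCast_atTop_atTop.comp numWords_strictMono.tendsto_atTop
  exact (tendsto_rpow_atTop hδ).comp ((tendsto_pow_atTop two_ne_zero).comp h)

lemma numBlocks_rpow_le (hp : 1 ≤ p) {γ : ℝ} (hγ0 : 0 < γ) (hγ1 : γ ≤ 1) (k : ℕ) :
    (numBlocks p k : ℝ) ^ γ ≤ 3 * ((numWords k : ℝ) ^ 2) ^ (p * γ) := by
  calc (numBlocks p k : ℝ) ^ γ ≤ (3 * ((numWords k : ℝ) ^ 2) ^ p) ^ γ :=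
        Real.rpow_le_rpow (by positivity) (numBlocks_le hp k) hγ0.le
    _ = 3 ^ γ * ((numWords k : ℝ) ^ 2) ^ (p * γ) := by
        rw [Real.mul_rpow (by positivity) (by positivity), ← Real.rpow_mul (by positivity)]
    _ ≤ _ := by
        gcongr
        exact Real.rpow_le_self_of_one_le (by norm_num) hγ1

/-- The ratio log N_k / l_k^γ is eventually nondecreasing: one step multiplies it by N_k² /
`numBlocks p k ^ γ`, and the denominator is at most 3 N_k^{2pγ} with pγ < 1. The constant is the
ratio at k₀. -/
lemma exists_mul_wordLen_rpow_le (hp : 1 ≤ p) {γ : ℝ} (hγ0 : 0 < γ) (hγ : γ < 1 / p) :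
    ∃ c > 0, ∃ k₀, ∀ k ≥ k₀, c * (wordLen p k : ℝ) ^ γ ≤ Real.log (numWords k) := by
  have hp0 : 0 < p := by linarith
  have hα1 : 1 / p ≤ 1 := by rw [div_le_one hp0]; exact hp
  have hδ : 0 < 1 - p * γ := by rw [lt_div_iff₀ hp0] at hγ; linarith
  obtain ⟨k₀, hk₀⟩ := eventually_atTop.1 ((tendsto_sq_numWords_rpow hδ).eventually_ge_atTop 3)
  have hl : ∀ k, (0 : ℝ) < wordLen p k := fun k => by exact_mod_cast wordLen_pos p k
  have hN : ∀ k, (1 : ℝ) < numWords k := fun k => by exact_mod_cast two_le_numWords k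
  have hlog : 0 < Real.log (numWords k₀) := Real.log_pos (hN k₀)
  have hlk := hl k₀
  refine ⟨Real.log (numWords k₀) / (wordLen p k₀ : ℝ) ^ γ, by positivity, k₀, fun k hk => ?_⟩
  induction k, hk using Nat.le_induction with
  | base => rw [div_mul_cancel₀ _ (by positivity)]
  | succ k hk ih =>
    have hN0 : (0 : ℝ) < (numWords k : ℝ) ^ 2 := by have := hN k; positivity
    have h1 : (numBlocks p k : ℝ) ^ γ ≤ (numWords k : ℝ) ^ 2 := by
      calc (numBlocks p k : ℝ) ^ γ ≤ 3 * ((numWords k : ℝ) ^ 2) ^ (p * γ) :=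
            numBlocks_rpow_le hp hγ0 (by linarith) k
        _ ≤ ((numWords k : ℝ) ^ 2) ^ (1 - p * γ) * ((numWords k : ℝ) ^ 2) ^ (p * γ) := by
            gcongr; exact hk₀ k hk
        _ = _ := by rw [← Real.rpow_add hN0]; simp
    rw [log_numWords_succ, wordLen, Nat.cast_mul, Real.mul_rpow (by positivity) (by positivity),
      mul_left_comm]
    exact mul_le_mul h1 ih (by have := hl k; positivity) hN0.le

/-- The lower bound for the complexity of the subshift. -/
lemma exists_mul_rpow_le_log_ncard_words (hp : 1 ≤ p) {γ : ℝ} (hγ0 : 0 < γ) (hγ : γ < 1 / p) :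
    ∃ c > 0, ∀ᶠ n : ℕ in atTop,
      c * (n : ℝ) ^ γ ≤ Real.log (words (hierSubshift p) n).ncard := by
  have hp0 : 0 < p := by linarith
  have hα0 : 0 < 1 / p := by positivity
  have hα1 : 1 / p ≤ 1 := by rw [div_le_one hp0]; exact hp
  obtain ⟨c, hc, k₀, hk₀⟩ := exists_mul_wordLen_rpow_le hp hγ0 hγ
  -- A factor 2 is lost in rounding n down to a multiple of `wordLen p k`, and a factor 3 in the
  -- bound `hJm`.
  refine ⟨c / 6, by positivity, eventually_atTop.2 ⟨wordLen p k₀, fun n hn => ?_⟩⟩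
  obtain ⟨k, hk, hk'⟩ := exists_wordLen_le_lt p ((wordLen_pos p k₀).trans_le hn)
  have hkk : k₀ ≤ k := Nat.lt_succ_iff.1 ((wordLen_strictMono p).lt_iff_lt.1 (hn.trans_lt hk'))
  have hl := wordLen_pos p k
  set m := n / wordLen p k with hm
  have hm1 : 1 ≤ m := (Nat.one_le_div_iff hl).2 hk
  have hm1' : (1 : ℝ) ≤ m := by exact_mod_cast hm1
  have hmL : m < numBlocks p k := by
    rw [hm, Nat.div_lt_iff_lt_mul hl]; exact hk'
  have hmL' : (m : ℝ) ≤ numBlocks p k := by exact_mod_cast hmL.le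
  have hnm : (n : ℝ) ≤ 2 * (m * wordLen p k) := by
    have h1 := Nat.lt_div_mul_add hl (a := n)
    have h2 : n ≤ 2 * (m * wordLen p k) := by nlinarith
    exact_mod_cast h2
  -- The number of free blocks among the first m: those j with j^p < m, as long as free blocks
  -- remain.
  set J := min (numWords k ^ 2) ⌈(m : ℝ) ^ (1 / p)⌉₊ with hJ
  have hpos : ∀ j < J, pos p j < m := by
    intro j hj
    have h1 : (j : ℝ) < (m : ℝ) ^ (1 / p) := Nat.lt_ceil.1 (hj.trans_le (min_le_right _ _))
    rw [pos, Nat.floor_lt (by positivity)]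
    rw [one_div] at h1
    exact (Real.lt_rpow_inv_iff_of_pos (by positivity) (by positivity) hp0).1 h1
  have hcard := pow_le_ncard_words hp (min_le_left _ _) hpos hmL.le (Nat.div_mul_le_self n _)
  have hmγ : (m : ℝ) ^ γ ≤ (m : ℝ) ^ (1 / p) := Real.rpow_le_rpow_of_exponent_le hm1' hγ.le
  have hJm : (m : ℝ) ^ γ / 3 ≤ J := by
    rw [hJ, Nat.cast_min, le_min_iff]
    constructor
    -- If all N_k² free blocks are used, then m ≤ `numBlocks p k` still gives m^{1/p} ≤ 3 N_k².
    · have h1 := numBlocks_rpow_le hp hα0 hα1 k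
      rw [mul_one_div_cancel hp0.ne', Real.rpow_one] at h1
      have h2 : (m : ℝ) ^ (1 / p) ≤ (numBlocks p k : ℝ) ^ (1 / p) :=
        Real.rpow_le_rpow (by positivity) hmL' hα0.le
      push_cast
      linarith
    · have h1 := Nat.le_ceil ((m : ℝ) ^ (1 / p))
      have : 0 ≤ (m : ℝ) ^ γ := by positivity
      linarith
  calc c / 6 * (n : ℝ) ^ γ ≤ c / 6 * (2 * (m * wordLen p k)) ^ γ := by gcongr
    _ = c / 6 * (2 ^ γ * ((m : ℝ) ^ γ * (wordLen p k : ℝ) ^ γ)) := by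
        rw [Real.mul_rpow (by positivity) (by positivity),
          Real.mul_rpow (by positivity) (by positivity)]
    _ ≤ c / 6 * (2 * ((m : ℝ) ^ γ * (wordLen p k : ℝ) ^ γ)) := by
        gcongr
        exact Real.rpow_le_self_of_one_le (by norm_num) (by linarith)
    _ = (m : ℝ) ^ γ / 3 * (c * (wordLen p k : ℝ) ^ γ) := by ring
    _ ≤ J * Real.log (numWords k) := mul_le_mul hJm (hk₀ k hkk) (by positivity) (by positivity)
    _ = Real.log ((numWords k ^ J : ℕ) : ℝ) := by rw [Nat.cast_pow, Real.log_pow]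
    _ ≤ _ := by
        refine Real.log_le_log ?_ (by exact_mod_cast hcard)
        exact_mod_cast pow_pos (numWords_pos k) J

theorem tendsto_log_ncard_words_zero (hp : 1 ≤ p) {β : ℝ} (hβ : 1 / p < β) :
    Tendsto (fun n : ℕ => Real.log ((words (hierSubshift p) n).ncard : ℝ) / (n : ℝ) ^ β)
      atTop (𝓝 0) := by
  have h1 : Tendsto (fun n : ℕ => (6 * p + 14) * (n : ℝ) ^ (-(β - 1 / p))) atTop (𝓝 0) := by
    simpa using ((tendsto_rpow_neg_atTop (sub_pos.2 hβ)).comp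
      tendsto_natCast_atTop_atTop).const_mul (6 * p + 14)
  refine tendsto_of_tendsto_of_tendsto_of_le_of_le' tendsto_const_nhds h1
    (Eventually.of_forall fun n => div_nonneg (Real.log_natCast_nonneg _) (by positivity))
    (eventually_atTop.2 ⟨1, fun n hn => ?_⟩)
  have hn0 : (0 : ℝ) < n := by exact_mod_cast hn
  rw [div_le_iff₀ (by positivity), mul_assoc, ← Real.rpow_add hn0]
  simpa using log_ncard_words_le hp hn

theorem tendsto_log_ncard_words_atTop (hp : 1 ≤ p) {β : ℝ} (hβ0 : 0 < β) (hβ : β < 1 / p) :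
    Tendsto (fun n : ℕ => Real.log ((words (hierSubshift p) n).ncard : ℝ) / (n : ℝ) ^ β)
      atTop atTop := by
  -- The lower bound is available only below 1 / p; the gap γ - β yields divergence.
  obtain ⟨γ, hβγ, hγ⟩ := exists_between hβ
  obtain ⟨c, hc, h⟩ := exists_mul_rpow_le_log_ncard_words hp (hβ0.trans hβγ) hγ
  have h1 : Tendsto (fun n : ℕ => c * (n : ℝ) ^ (γ - β)) atTop atTop :=
    ((tendsto_rpow_atTop (sub_pos.2 hβγ)).comp tendsto_natCast_atTop_atTop).const_mul_atTop hc
  refine tendsto_atTop_mono' _ ?_ h1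
  filter_upwards [h, eventually_ge_atTop 1] with n hn hn1
  have hn0 : (0 : ℝ) < n := by exact_mod_cast hn1
  rw [le_div_iff₀ (by positivity), mul_assoc, ← Real.rpow_add hn0]
  simpa using hn

/-! ### Unique ergodicity -/

open BoundedContinuousFunction

/-! ### Birkhoff sums and invariant measures of general systems. -/

section General

variable {X : Type*} {T : X → X}

lemma abs_birkhoffSum_le {f : X → ℝ} {B : ℝ} (hf : ∀ x, |f x| ≤ B) (n : ℕ) (x : X) :
    |birkhoffSum T f n x| ≤ n * B := by
  calc |birkhoffSum T f n x| ≤ ∑ i ∈ Finset.range n, |f (T^[i] x)| := Finset.abs_sum_le_sum_abs _ _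
    _ ≤ ∑ i ∈ Finset.range n, B := Finset.sum_le_sum fun i _ => hf _
    _ = n * B := by simp

/-- Splitting the sum of length n + r after r or after n terms leaves only two sums of length r. -/
lemma abs_birkhoffSum_iterate_sub_le {f : X → ℝ} {B : ℝ} (hf : ∀ x, |f x| ≤ B) (n r : ℕ) (x : X) :
    |birkhoffSum T f n (T^[r] x) - birkhoffSum T f n x| ≤ 2 * (r * B) := by
  have h1 := birkhoffSum_add T f r n x
  have h2 := birkhoffSum_add T f n r x
  rw [add_comm n r] at h2
  have h3 := abs_birkhoffSum_le (T := T) hf r x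
  have h4 := abs_birkhoffSum_le (T := T) hf r (T^[n] x)
  rw [abs_le] at *
  constructor <;> linarith

variable [TopologicalSpace X] [MeasurableSpace X] [BorelSpace X]

lemma integral_birkhoffSum (hT : Continuous T) {μ : Measure X} [IsProbabilityMeasure μ]
    (hμ : MeasurePreserving T μ μ) (f : X →ᵇ ℝ) (n : ℕ) :
    ∫ x, birkhoffSum T f n x ∂μ = n * ∫ x, f x ∂μ := by
  have h : ∀ i : ℕ, ∫ x, f (T^[i] x) ∂μ = ∫ x, f x ∂μ := fun i => by
    have hi := hμ.iterate i
    conv_rhs => rw [← hi.map_eq]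
    exact (integral_map hi.measurable.aemeasurable f.continuous.aestronglyMeasurable).symm
  simp only [birkhoffSum]
  rw [integral_finsetSum]
  · simp [h]
  · intro i _
    exact (f.compContinuous ⟨T^[i], hT.iterate i⟩).integrable μ

/-- **Krylov–Bogolyubov**: a continuous self-map of a nonempty compact space has an invariant
probability measure. -/
lemma exists_invariant_probabilityMeasure [CompactSpace X] [T2Space X] [HasOuterApproxClosed X]
    [Nonempty X] (hT : Continuous T) :
    ∃ μ : Measure X, IsProbabilityMeasure μ ∧ MeasurePreserving T μ μ := by
  obtain ⟨x⟩ := ‹Nonempty X›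
  let m : ℕ → Measure X := fun n =>
    ((n + 1 : ℕ) : ℝ≥0∞)⁻¹ • ∑ i ∈ Finset.range (n + 1), Measure.dirac (T^[i] x)
  have hm : ∀ n, IsProbabilityMeasure (m n) := fun n => ⟨by
    simp only [m, Measure.smul_apply, Measure.finsetSum_apply, measure_univ, Finset.sum_const,
      Finset.card_range, smul_eq_mul, nsmul_eq_mul, mul_one]
    exact ENNReal.inv_mul_cancel (by simp) (ENNReal.natCast_ne_top _)⟩
  have hint : ∀ n (f : X →ᵇ ℝ), ∫ y, f y ∂(m n) = birkhoffAverage ℝ T f (n + 1) x := fun n f => by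
    simp only [m, integral_smul_measure]
    rw [integral_finsetSum_measure fun i _ => f.integrable _]
    simp [integral_dirac, birkhoffAverage, birkhoffSum, ENNReal.toReal_add]
  -- Compactness of the space of probability measures gives a limit of the empirical measures along
  -- any ultrafilter; a free one is needed for vanishing boundary terms.
  let F : Ultrafilter ℕ := hyperfilter ℕ
  let P : ℕ → ProbabilityMeasure X := fun n => ⟨m n, hm n⟩
  obtain ⟨μ, -, hμ⟩ := isCompact_univ.ultrafilter_le_nhds (F.map P) (by simp)
  have hlim : ∀ f : X →ᵇ ℝ, Tendsto (fun n => birkhoffAverage ℝ T f (n + 1) x) F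
      (𝓝 (∫ y, f y ∂(μ : Measure X))) := fun f => by
    have hP : Tendsto P F (𝓝 μ) := hμ
    exact (ProbabilityMeasure.tendsto_iff_forall_integral_tendsto.1 hP f).congr fun n => hint n f
  refine ⟨μ, inferInstance, hT.measurable, ?_⟩
  have : IsProbabilityMeasure (Measure.map T (μ : Measure X)) :=
    Measure.isProbabilityMeasure_map hT.measurable.aemeasurable
  refine ext_of_forall_integral_eq_of_IsFiniteMeasure fun f => ?_
  rw [integral_map hT.measurable.aemeasurable f.continuous.aestronglyMeasurable]
  have h1 := hlim f
  have h2 := hlim (f.compContinuous ⟨T, hT⟩)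
  have h3 : Tendsto (fun n => birkhoffAverage ℝ T f n (T x) - birkhoffAverage ℝ T f n x)
      atTop (𝓝 0) := by
    refine tendsto_birkhoffAverage_apply_sub_birkhoffAverage ℝ ?_
    exact f.isBounded_range.subset (range_subset_iff.2 fun i => mem_range_self _)
  have h4 : Tendsto (fun n => birkhoffAverage ℝ T f (n + 1) (T x) -
      birkhoffAverage ℝ T f (n + 1) x) F (𝓝 0) :=
    (h3.comp (tendsto_add_atTop_nat 1)).mono_left (Nat.hyperfilter_le_atTop)
  have h5 : ∀ n, birkhoffAverage ℝ T (f.compContinuous ⟨T, hT⟩) n x =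
      birkhoffAverage ℝ T f n (T x) := fun n => by
    simp only [birkhoffAverage, birkhoffSum, BoundedContinuousFunction.compContinuous_apply,
      ContinuousMap.coe_mk, ← Function.iterate_succ_apply', Function.iterate_succ_apply]
  simp only [h5] at h2
  have h6 := tendsto_nhds_unique h4 (h2.sub h1)
  exact (sub_eq_zero.1 h6.symm)

/-- A system whose Birkhoff averages have small oscillation is uniquely ergodic. -/
theorem isUniquelyErgodic_of_birkhoffSum [CompactSpace X] [T2Space X] [HasOuterApproxClosed X]
    [Nonempty X] (hT : Continuous T)
    (h : ∀ f : X →ᵇ ℝ, ∀ ε > 0, ∃ n : ℕ, 0 < n ∧ ∀ x y,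
      |birkhoffSum T f n x - birkhoffSum T f n y| ≤ n * ε) :
    IsUniquelyErgodic T := by
  -- Integrating the Birkhoff sum against an invariant measure gives n ∫ f, which is thus pinned
  -- near its value at z, whatever the measure.
  have key : ∀ (f : X →ᵇ ℝ) (n : ℕ) (ε : ℝ) (z : X),
      (∀ x, |birkhoffSum T f n x - birkhoffSum T f n z| ≤ n * ε) → ∀ μ : Measure X,
      IsProbabilityMeasure μ → MeasurePreserving T μ μ →
      |n * ∫ x, f x ∂μ - birkhoffSum T f n z| ≤ n * ε := by
    intro f n ε z hz μ hμ hμT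
    have hi : Integrable (fun x => birkhoffSum T f n x) μ :=
      integrable_finsetSum _ fun i _ => (f.compContinuous ⟨T^[i], hT.iterate i⟩).integrable μ
    have h1 : n * ∫ x, f x ∂μ - birkhoffSum T f n z =
        ∫ x, (birkhoffSum T f n x - birkhoffSum T f n z) ∂μ := by
      rw [integral_sub hi (integrable_const _), integral_birkhoffSum hT hμT]
      simp
    rw [h1, ← Real.norm_eq_abs]
    have h2 : ∀ᵐ x ∂μ, ‖birkhoffSum T f n x - birkhoffSum T f n z‖ ≤ n * ε :=
      Eventually.of_forall hz
    simpa using norm_integral_le_of_norm_le_const h2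
  obtain ⟨μ, hμ, hμT⟩ := exists_invariant_probabilityMeasure hT
  refine ⟨μ, ⟨hμ, hμT⟩, fun ν ⟨hν, hνT⟩ => ?_⟩
  refine ext_of_forall_integral_eq_of_IsFiniteMeasure fun f => ?_
  refine eq_of_forall_dist_le fun ε hε => ?_
  obtain ⟨n, hn, hxy⟩ := h f (ε / 2) (by positivity)
  obtain ⟨z⟩ := ‹Nonempty X›
  have h1 := key f n _ z (fun x => hxy x z) μ hμ hμT
  have h2 := key f n _ z (fun x => hxy x z) ν hν hνT
  have hn' : (0 : ℝ) < n := by exact_mod_cast hn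
  rw [Real.dist_eq]
  refine le_of_mul_le_mul_left ?_ hn'
  rw [← abs_of_pos hn', ← abs_mul, abs_of_pos hn']
  rw [abs_le] at *
  constructor <;> linarith

end General

/-- Lebesgue's number lemma for subshifts. -/
lemma exists_uniform_window (X : Subshift (Fin 2) ℤ) {𝒰 : Set (Set X.carrier)}
    (h𝒰 : ∀ U ∈ 𝒰, IsOpen U) (hcov : ⋃₀ 𝒰 = univ) :
    ∃ M : ℕ, ∀ x : X.carrier, ∃ U ∈ 𝒰, ∀ y : X.carrier,
      (∀ i : ℤ, |i| ≤ M → (y : ℤ → Fin 2) i = (x : ℤ → Fin 2) i) → y ∈ U := by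
  have h : ∀ x : X.carrier, ∃ M : ℕ, ∃ U ∈ 𝒰, ∀ y : X.carrier,
      (∀ i : ℤ, |i| ≤ M → (y : ℤ → Fin 2) i = (x : ℤ → Fin 2) i) → y ∈ U := fun x => by
    obtain ⟨U, hU, hx⟩ := mem_sUnion.1 (hcov.symm ▸ mem_univ x)
    obtain ⟨M, hM⟩ := exists_window_subset ((h𝒰 U hU).mem_nhds hx)
    exact ⟨M, U, hU, hM⟩
  choose M U hU hM using h
  have hnhds : ∀ x : X.carrier, {y : X.carrier | ∀ i : ℤ, |i| ≤ M x →
      (y : ℤ → Fin 2) i = (x : ℤ → Fin 2) i} ∈ 𝓝 x := fun x => by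
    have h1 : {y : X.carrier | ∀ i : ℤ, |i| ≤ M x → (y : ℤ → Fin 2) i = (x : ℤ → Fin 2) i} =
        Subtype.val ⁻¹' SymbolicDynamics.FullShift.cylinder (Finset.Icc (-(M x : ℤ)) (M x))
          (x : ℤ → Fin 2) := by
      ext y; simp [SymbolicDynamics.FullShift.cylinder, abs_le]
    rw [h1]
    exact ((isOpen_cylinder _ _).preimage continuous_subtype_val).mem_nhds fun i _ => rfl
  obtain ⟨t, ht⟩ := CompactSpace.elim_nhds_subcover _ hnhds
  refine ⟨t.sup M, fun x => ?_⟩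
  have hx : x ∈ ⋃ z ∈ t, {y : X.carrier | ∀ i : ℤ, |i| ≤ M z →
      (y : ℤ → Fin 2) i = (z : ℤ → Fin 2) i} := by rw [ht]; trivial
  simp only [mem_iUnion, exists_prop] at hx
  obtain ⟨z, hz, hxz⟩ := hx
  refine ⟨U z, hU z, fun y hy => hM z y fun i hi => ?_⟩
  rw [hy i (hi.trans (by exact_mod_cast Finset.le_sup (f := M) hz)), hxz i hi]

open scoped Classical in
/-- Two sequences that differ at few places agree on most windows. -/
lemma card_window_ne_le (x y : ℤ → Fin 2) (n M : ℕ) :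
    ((Finset.range n).filter fun t : ℕ => ∃ i : ℤ, |i| ≤ M ∧ x (t + i) ≠ y (t + i)).card ≤
      (2 * M + 1) * (((Finset.range n).filter fun u : ℕ => x u ≠ y u).card + 2 * M) := by
  -- Besides the differences in [0, n), the 2M places just outside are counted as bad, since windows
  -- may reach them.
  set S : Finset ℤ := (((Finset.range n).filter fun u : ℕ => x u ≠ y u).image fun u : ℕ => (u : ℤ))
    ∪ (Finset.Ico (-(M : ℤ)) 0 ∪ Finset.Ico (n : ℤ) (n + M)) with hS
  have hScard : S.card ≤ ((Finset.range n).filter fun u : ℕ => x u ≠ y u).card + 2 * M := by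
    refine (Finset.card_union_le _ _).trans (Nat.add_le_add Finset.card_image_le ?_)
    refine (Finset.card_union_le _ _).trans ?_
    simp only [Int.card_Ico]; omega
  have hsub : ((Finset.range n).filter fun t : ℕ => ∃ i : ℤ, |i| ≤ M ∧ x (t + i) ≠ y (t + i)) ⊆
      (Finset.Icc (-(M : ℤ)) M ×ˢ S).image fun a => (a.2 - a.1).toNat := by
    intro t ht
    simp only [Finset.mem_filter, Finset.mem_range] at ht
    obtain ⟨htn, i, hi, hne⟩ := ht
    rw [abs_le] at hi
    refine Finset.mem_image.2 ⟨(i, t + i), ?_, by simp⟩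
    simp only [Finset.mem_product, Finset.mem_Icc, hS, Finset.mem_union, Finset.mem_image,
      Finset.mem_filter, Finset.mem_range, Finset.mem_Ico]
    refine ⟨hi, ?_⟩
    by_cases h0 : (t : ℤ) + i < 0
    · right; left; omega
    by_cases h1 : (n : ℤ) ≤ t + i
    · right; right; omega
    left
    obtain ⟨u, hu⟩ := Int.eq_ofNat_of_zero_le (not_lt.1 h0)
    rw [hu] at hne
    exact ⟨u, ⟨by omega, hne⟩, hu.symm⟩
  refine (Finset.card_le_card hsub).trans (Finset.card_image_le.trans ?_)
  rw [Finset.card_product, Int.card_Icc]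
  have : ((M : ℤ) + 1 - -(M : ℤ)).toNat = 2 * M + 1 := by omega
  rw [this]
  exact Nat.mul_le_mul_left _ hScard

open scoped Classical in
/-- The Birkhoff sums along two words of level `k + 1` are close. -/
lemma abs_birkhoffSum_sub_le_of_isConcatAt (hp : 1 ≤ p) {f : (hierSubshift p).carrier → ℝ}
    {B ε : ℝ} (hB : ∀ x, |f x| ≤ B) (hε : 0 ≤ ε) {M : ℕ}
    (hM : ∀ x y : (hierSubshift p).carrier,
      (∀ i : ℤ, |i| ≤ M → (x : ℤ → Fin 2) i = (y : ℤ → Fin 2) i) → |f x - f y| ≤ ε)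
    {k : ℕ} {x y : (hierSubshift p).carrier} (hx : IsConcatAt p (k + 1) x 0)
    (hy : IsConcatAt p (k + 1) y 0) :
    |birkhoffSum (shiftMap _) f (wordLen p (k + 1)) x -
      birkhoffSum (shiftMap _) f (wordLen p (k + 1)) y| ≤ wordLen p (k + 1) * ε +
        (2 * M + 1) * (numWords k ^ 2 * wordLen p k + 2 * M) * (2 * B) := by
  obtain ⟨c, -, hc⟩ := hx 0
  obtain ⟨d, -, hd⟩ := hy 0
  have hB0 : 0 ≤ B := (abs_nonneg _).trans (hB x)
  simp only [zero_mul, zero_add] at hc hd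
  set bad := (Finset.range (wordLen p (k + 1))).filter fun t : ℕ => ∃ i : ℤ, |i| ≤ M ∧
    (x : ℤ → Fin 2) (t + i) ≠ (y : ℤ → Fin 2) (t + i) with hbad
  have hcard : bad.card ≤ (2 * M + 1) * (numWords k ^ 2 * wordLen p k + 2 * M) := by
    refine (card_window_ne_le _ _ _ _).trans (Nat.mul_le_mul_left _ (Nat.add_le_add_right ?_ _))
    refine le_trans (le_of_eq ?_) (card_word_ne_le hp k c d)
    congr 1
    refine Finset.filter_congr fun u hu => ?_
    rw [Finset.mem_range] at hu
    rw [hc u hu, hd u hu]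
  have hterm : ∀ t ∈ Finset.range (wordLen p (k + 1)),
      |f ((shiftMap _)^[t] x) - f ((shiftMap _)^[t] y)| ≤ ε + if t ∈ bad then 2 * B else 0 := by
    intro t ht
    split_ifs with h
    · have h1 := hB ((shiftMap _)^[t] x)
      have h2 := hB ((shiftMap _)^[t] y)
      rw [abs_le] at *
      constructor <;> linarith
    · rw [add_zero]
      refine hM _ _ fun i hi => ?_
      rw [iterate_shiftMap_apply, iterate_shiftMap_apply]
      by_contra hne
      exact h (Finset.mem_filter.2 ⟨ht, i, hi, hne⟩)
  calc |birkhoffSum (shiftMap _) f (wordLen p (k + 1)) x -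
      birkhoffSum (shiftMap _) f (wordLen p (k + 1)) y|
      = |∑ t ∈ Finset.range (wordLen p (k + 1)),
          (f ((shiftMap _)^[t] x) - f ((shiftMap _)^[t] y))| := by
        rw [Finset.sum_sub_distrib]; rfl
    _ ≤ ∑ t ∈ Finset.range (wordLen p (k + 1)), (ε + if t ∈ bad then 2 * B else 0) :=
        (Finset.abs_sum_le_sum_abs _ _).trans (Finset.sum_le_sum hterm)
    _ = wordLen p (k + 1) * ε + bad.card * (2 * B) := by
        rw [Finset.sum_add_distrib, ← Finset.sum_filter, Finset.sum_const, Finset.sum_const,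
          Finset.card_range, nsmul_eq_mul, nsmul_eq_mul]
        congr 4
        ext t; simp [hbad]
    _ ≤ _ := by
        gcongr
        exact_mod_cast hcard

/-- Words of level `k + 1` mostly consist of fixed blocks. -/
lemma tendsto_free_proportion (hp : 1 < p) (M : ℝ) :
    Tendsto (fun k => ((numWords k : ℝ) ^ 2 * wordLen p k + M) / wordLen p (k + 1))
      atTop (𝓝 0) := by
  have hl : ∀ k, (0 : ℝ) < wordLen p k := fun k => by exact_mod_cast wordLen_pos p k
  have hN : ∀ k, (0 : ℝ) < numWords k := fun k => by exact_mod_cast numWords_pos k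
  have hL : ∀ k, (0 : ℝ) < numBlocks p k := fun k => by exact_mod_cast numBlocks_pos p k
  have h1 : Tendsto (fun k => ((numWords k : ℝ) ^ 2) / numBlocks p k) atTop (𝓝 0) := by
    -- Strictness of p > 1 enters here: the proportion is at most (N_k²)^{-(p-1)}.
    have h2 := (tendsto_sq_numWords_rpow (sub_pos.2 hp)).inv_tendsto_atTop
    refine squeeze_zero (fun k => by positivity) (fun k => ?_) h2
    have hk := hN k
    rw [Pi.inv_apply, div_le_iff₀ (hL k), le_inv_mul_iff₀ (by positivity)]
    refine le_trans (le_of_eq ?_) (sq_rpow_le_numBlocks p k)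
    rw [Real.rpow_sub_one (by positivity)]; field_simp
  have h3 : Tendsto (fun k => M / (wordLen p (k + 1) : ℝ)) atTop (𝓝 0) :=
    (tendsto_natCast_atTop_atTop.comp ((wordLen_strictMono p).tendsto_atTop.comp
      (tendsto_add_atTop_nat 1))).const_div_atTop M
  have h4 := h1.add h3
  rw [add_zero] at h4
  refine h4.congr fun k => ?_
  have := (hl k).ne'
  have := (hL k).ne'
  rw [wordLen]; push_cast; field_simp

lemma isConcatAt_iterate {k : ℕ} {x : (hierSubshift p).carrier} {r : ℕ}
    (h : IsConcatAt p k x r) : IsConcatAt p k ((shiftMap (hierSubshift p))^[r] x : _) 0 := by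
  have h1 : (((shiftMap (hierSubshift p))^[r] x : (hierSubshift p).carrier) : ℤ → Fin 2) =
      shift (r : ℤ) (x : ℤ → Fin 2) := by
    ext1 i; rw [iterate_shiftMap_apply, shift_apply]
  rw [h1]
  simpa using h.shift r

lemma abs_birkhoffSum_mul_sub_le {k : ℕ} {f : (hierSubshift p).carrier → ℝ} {v E : ℝ}
    (h : ∀ z : (hierSubshift p).carrier, IsConcatAt p k z 0 →
      |birkhoffSum (shiftMap _) f (wordLen p k) z - v| ≤ E) (Q : ℕ)
    (z : (hierSubshift p).carrier) (hz : IsConcatAt p k z 0) :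
    |birkhoffSum (shiftMap _) f (Q * wordLen p k) z - Q * v| ≤ Q * E := by
  induction Q generalizing z with
  | zero => simp
  | succ Q ih =>
    rw [add_mul, one_mul, add_comm, birkhoffSum_add]
    have h1 := h z hz
    have h2 := ih _ (isConcatAt_iterate (r := wordLen p k) (by simpa using hz.add_mul 1))
    push_cast
    rw [abs_le] at *
    constructor <;> linarith

theorem isUniquelyErgodic_hierSubshift (hp : 1 < p) :
    IsUniquelyErgodic (shiftMap (hierSubshift p)) := by
  have : Nonempty (hierSubshift p).carrier := (hierSubshift_nonempty p).to_subtype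
  refine isUniquelyErgodic_of_birkhoffSum (continuous_shiftMap _) fun f ε' hε' => ?_
  -- Per letter, the comparison of words costs 2ε and the alignment another 2ε; comparing two points
  -- through v doubles this.
  obtain ⟨ε, hε, rfl⟩ : ∃ ε > 0, ε' = 8 * ε := ⟨ε' / 8, by positivity, by ring⟩
  have hB : ∀ x, |f x| ≤ ‖f‖ := fun x => f.norm_coe_le_norm x
  set B := ‖f‖ with hBdef
  have hB0 : 0 ≤ B := norm_nonneg f
  obtain ⟨M, hM⟩ : ∃ M : ℕ, ∀ x y : (hierSubshift p).carrier,
      (∀ i : ℤ, |i| ≤ M → (x : ℤ → Fin 2) i = (y : ℤ → Fin 2) i) → |f x - f y| ≤ ε := by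
    -- Uniform continuity of f, from the cover by preimages of balls of radius ε / 2.
    obtain ⟨M, hM⟩ := exists_uniform_window (hierSubshift p)
      (𝒰 := range fun c : ℝ => f ⁻¹' Metric.ball c (ε / 2))
      (by rintro _ ⟨c, rfl⟩; exact Metric.isOpen_ball.preimage f.continuous)
      (eq_univ_of_forall fun x => ⟨_, ⟨f x, rfl⟩, Metric.mem_ball_self (by positivity)⟩)
    refine ⟨M, fun x y hxy => ?_⟩
    obtain ⟨_, ⟨c, rfl⟩, hU⟩ := hM y
    have h1 := hU x hxy
    have h2 := hU y fun _ _ => rfl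
    rw [mem_preimage, Metric.mem_ball, Real.dist_eq, abs_lt] at h1 h2
    rw [abs_le]; constructor <;> linarith
  obtain ⟨k, hk⟩ : ∃ k, (2 * M + 1) * (numWords k ^ 2 * wordLen p k + 2 * M) * (2 * B) ≤
      wordLen p (k + 1) * ε := by
    have h1 := (tendsto_free_proportion hp (2 * M)).const_mul ((2 * M + 1) * (2 * B))
    rw [mul_zero] at h1
    obtain ⟨k, hk⟩ := (h1.eventually_le_const hε).exists
    have hl : (0 : ℝ) < wordLen p (k + 1) := by exact_mod_cast wordLen_pos p (k + 1)
    refine ⟨k, ?_⟩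
    rw [← mul_div_assoc, div_le_iff₀ hl] at hk
    linarith
  have hl : (0 : ℝ) < wordLen p (k + 1) := by exact_mod_cast wordLen_pos p (k + 1)
  have halign : ∀ x : (hierSubshift p).carrier, ∃ r < wordLen p (k + 1),
      IsConcatAt p (k + 1) ((shiftMap (hierSubshift p))^[r] x : _) 0 := fun x => by
    obtain ⟨r, h0, h1, hr⟩ := exists_isConcatAt_mem_Ico (mem_hierSubshift.1 x.2 (k + 1)) 0
    lift r to ℕ using h0
    exact ⟨r, by omega, isConcatAt_iterate hr⟩
  obtain ⟨z, hz⟩ : ∃ z : (hierSubshift p).carrier, IsConcatAt p (k + 1) z 0 := by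
    obtain ⟨x⟩ := this
    obtain ⟨r, -, hr⟩ := halign x
    exact ⟨_, hr⟩
  -- Enough words are concatenated for the cost of aligning x, at most 2rB with r below one word
  -- length, to be negligible.
  obtain ⟨Q, hQ⟩ := exists_nat_ge (B / ε)
  have hQB : B ≤ (Q + 1 : ℕ) * ε := by
    rw [div_le_iff₀ hε] at hQ; push_cast; linarith
  set v := birkhoffSum (shiftMap (hierSubshift p)) f (wordLen p (k + 1)) z with hv
  have hblock : ∀ y : (hierSubshift p).carrier, IsConcatAt p (k + 1) y 0 →
      |birkhoffSum (shiftMap _) f (wordLen p (k + 1)) y - v| ≤ 2 * (wordLen p (k + 1) * ε) :=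
    fun y hy => (abs_birkhoffSum_sub_le_of_isConcatAt hp.le hB hε.le hM hy hz).trans (by linarith)
  have hsum : ∀ x, |birkhoffSum (shiftMap _) f ((Q + 1) * wordLen p (k + 1)) x - (Q + 1 : ℕ) * v| ≤
      4 * (((Q + 1) * wordLen p (k + 1) : ℕ) * ε) := fun x => by
    obtain ⟨r, hr, hx⟩ := halign x
    have h1 := abs_birkhoffSum_mul_sub_le hblock (Q + 1) _ hx
    have h2 := abs_birkhoffSum_iterate_sub_le (T := shiftMap (hierSubshift p)) hB
      ((Q + 1) * wordLen p (k + 1)) r x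
    have h3 : (r : ℝ) * B ≤ wordLen p (k + 1) * ((Q + 1 : ℕ) * ε) := by gcongr
    push_cast at *
    rw [abs_le] at *
    constructor <;> linarith
  refine ⟨(Q + 1) * wordLen p (k + 1), by have := wordLen_pos p (k + 1); positivity,
    fun x y => ?_⟩
  have h1 := hsum x
  have h2 := hsum y
  rw [abs_le] at *
  constructor <;> linarith

/-! ### Entropy dimension of a subshift -/

lemma upperRate_eq_zero {a : ℕ → ℕ} {β : ℝ}
    (h : Tendsto (fun n : ℕ => Real.log (a n) / (n : ℝ) ^ β) atTop (𝓝 0)) :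
    upperRate a β = 0 := by
  rw [upperRate, (ENNReal.tendsto_ofReal h).limsup_eq, ENNReal.ofReal_zero]

lemma lowerRate_eq_top {a : ℕ → ℕ} {β : ℝ}
    (h : Tendsto (fun n : ℕ => Real.log (a n) / (n : ℝ) ^ β) atTop atTop) :
    lowerRate a β = ⊤ :=
  (ENNReal.tendsto_ofReal_atTop.comp h).liminf_eq

lemma lowerRate_le_upperRate (a : ℕ → ℕ) (β : ℝ) : lowerRate a β ≤ upperRate a β :=
  liminf_le_limsup

lemma criticalValue_mono {D E : ℝ → ℝ≥0∞} (h : ∀ β, D β ≤ E β) :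
    criticalValue D ≤ criticalValue E :=
  iInf₂_mono fun β _ => le_iInf fun h0 => iInf_le_of_le (le_zero_iff.1 (h0 ▸ h β)) le_rfl

lemma lowerEntropyDim_le_upperEntropyDim {X : Type*} [TopologicalSpace X] (T : X → X) :
    lowerEntropyDim T ≤ upperEntropyDim T :=
  iSup₂_mono fun _ _ => criticalValue_mono (lowerRate_le_upperRate _)

/-- A word of length `n` appears at any prescribed position of a suitable point. -/
lemma exists_point_of_mem_words {X : Subshift (Fin 2) ℤ} {n : ℕ} {w : Fin n → Fin 2}
    (hw : w ∈ words X n) (a : ℤ) :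
    ∃ x : X.carrier, ∀ t : Fin n, (x : ℤ → Fin 2) (a + (t : ℕ)) = w t := by
  obtain ⟨x, hx, i, h⟩ := hw
  refine ⟨⟨shift (i - a) x, X.mapsTo _ hx⟩, fun t => ?_⟩
  rw [h t]
  change x (i - a + (a + (t : ℕ))) = _
  congr 1; ring

/-- The letters on [-M, n + M) determine the windows of radius M around 0, ..., n - 1. With M a
Lebesgue number of the cover, each such cylinder lies in one element of the iterated cover. -/
lemma exists_minSubcover_le (X : Subshift (Fin 2) ℤ) {𝒰 : Set (Set X.carrier)}
    (h𝒰 : IsFiniteOpenCover 𝒰) :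
    ∃ M, ∀ n, minSubcover (iteratedCover (shiftMap X) 𝒰 n) ≤ (words X (n + 2 * M)).ncard := by
  classical
  obtain ⟨M, hM⟩ := exists_uniform_window X h𝒰.2.1 h𝒰.2.2
  choose U hU hUM using hM
  refine ⟨M, fun n => ?_⟩
  have hpt : ∀ w : words X (n + 2 * M), ∃ x : X.carrier, ∀ t : Fin (n + 2 * M),
      (x : ℤ → Fin 2) (-M + (t : ℕ)) = w.1 t := fun w => exists_point_of_mem_words w.2 _
  choose x hx using hpt
  let V : words X (n + 2 * M) → Set X.carrier := fun w =>
    ⋂ i : Fin n, (shiftMap X)^[(i : ℕ)] ⁻¹' U ((shiftMap X)^[(i : ℕ)] (x w))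
  have : Fintype (words X (n + 2 * M)) := (toFinite _).fintype
  suffices h : ((Finset.univ.image V : Finset (Set X.carrier)) : Set (Set X.carrier)) ⊆
      iteratedCover (shiftMap X) 𝒰 n ∧
      ⋃₀ ((Finset.univ.image V : Finset (Set X.carrier)) : Set (Set X.carrier)) = univ ∧
      (Finset.univ.image V).card ≤ (words X (n + 2 * M)).ncard from
    h.2.2.trans' (by unfold minSubcover; exact Nat.sInf_le ⟨_, h.1, h.2.1, rfl⟩)
  refine ⟨?_, ?_, ?_⟩
  · intro S hS
    obtain ⟨w, -, rfl⟩ := Finset.mem_image.1 (Finset.mem_coe.1 hS)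
    exact ⟨_, fun i => hU _, rfl⟩
  · refine eq_univ_of_forall fun y => ?_
    let w : words X (n + 2 * M) := ⟨fun t => (y : ℤ → Fin 2) (-M + (t : ℕ)), y, y.2, -M,
      fun t => rfl⟩
    refine mem_sUnion.2 ⟨V w, Finset.mem_coe.2 (Finset.mem_image_of_mem _ (Finset.mem_univ _)),
      mem_iInter.2 fun i => hUM _ _ fun j hj => ?_⟩
    rw [iterate_shiftMap_apply, iterate_shiftMap_apply]
    rw [abs_le] at hj
    have hi := i.2
    have h := hx w ⟨((i : ℕ) + j + M).toNat, by omega⟩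
    simp only [w] at h
    rw [Int.toNat_of_nonneg (by omega), show -(M : ℤ) + ((i : ℕ) + j + M) = (i : ℕ) + j by ring]
      at h
    exact h.symm
  · refine Finset.card_image_le.trans ?_
    rw [Finset.card_univ, ← Nat.card_eq_fintype_card]; rfl

/-- The partition of a subshift according to the letter at the origin. -/
def originCover (X : Subshift (Fin 2) ℤ) : Set (Set X.carrier) :=
  range fun a : Fin 2 => {x : X.carrier | (x : ℤ → Fin 2) 0 = a}

lemma isFiniteOpenCover_originCover (X : Subshift (Fin 2) ℤ) :
    IsFiniteOpenCover (originCover X) := by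
  refine ⟨finite_range _, ?_, eq_univ_of_forall fun x => ⟨_, ⟨_, rfl⟩, rfl⟩⟩
  rintro _ ⟨a, rfl⟩
  have h : Continuous fun x : X.carrier => (x : ℤ → Fin 2) 0 :=
    (continuous_apply 0).comp continuous_subtype_val
  exact (isOpen_discrete {a}).preimage h

lemma iteratedCover_originCover (X : Subshift (Fin 2) ℤ) (n : ℕ) :
    iteratedCover (shiftMap X) (originCover X) n =
      range fun w : Fin n → Fin 2 =>
        {x : X.carrier | ∀ i : Fin n, (x : ℤ → Fin 2) (i : ℕ) = w i} := by
  have h : ∀ w : Fin n → Fin 2, (⋂ i : Fin n, (shiftMap X)^[(i : ℕ)] ⁻¹'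
      {x : X.carrier | (x : ℤ → Fin 2) 0 = w i}) =
      {x : X.carrier | ∀ i : Fin n, (x : ℤ → Fin 2) (i : ℕ) = w i} := fun w => by
    ext x; simp [iterate_shiftMap_apply]
  ext S
  constructor
  · rintro ⟨U, hU, rfl⟩
    choose w hw using hU
    refine ⟨w, ?_⟩
    simp only [← hw, h]
  · rintro ⟨w, rfl⟩
    exact ⟨_, fun i => ⟨w i, rfl⟩, (h w).symm⟩

/-- The iterated origin cover is a partition into cylinders, so a subcover cannot omit the cylinder
of a word that appears. -/
lemma ncard_words_le_minSubcover (X : Subshift (Fin 2) ℤ) (n : ℕ) :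
    (words X n).ncard ≤ minSubcover (iteratedCover (shiftMap X) (originCover X) n) := by
  rw [iteratedCover_originCover]
  set C : (Fin n → Fin 2) → Set X.carrier :=
    fun w => {x : X.carrier | ∀ i : Fin n, (x : ℤ → Fin 2) (i : ℕ) = w i} with hC
  have hpt : ∀ w ∈ words X n, ∃ x : X.carrier, x ∈ C w := fun w hw => by
    obtain ⟨x, hx⟩ := exists_point_of_mem_words hw 0
    exact ⟨x, fun i => by simpa using hx i⟩
  have huniq : ∀ {w w' x}, x ∈ C w → x ∈ C w' → w = w' := fun {w w' x} h h' => by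
    ext1 i; exact (h i).symm.trans (h' i)
  -- In ℕ the infimum of the empty set is 0, so some finite subcover must be exhibited: the whole
  -- cover.
  refine le_csInf ⟨_, (finite_range C).toFinset, by simp, ?_, rfl⟩ ?_
  · rw [Finite.coe_toFinset]
    exact eq_univ_of_forall fun x => ⟨_, ⟨fun i => (x : ℤ → Fin 2) (i : ℕ), rfl⟩, fun i => rfl⟩
  · rintro _ ⟨F, hF, hcov, rfl⟩
    rw [← ncard_coe_finset]
    refine ncard_le_ncard_of_injOn C (fun w hw => ?_) (fun w hw w' hw' hww' => ?_)
      (Finset.finite_toSet F)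
    · obtain ⟨x, hx⟩ := hpt w hw
      obtain ⟨V, hV, hxV⟩ := mem_sUnion.1 (hcov.symm ▸ mem_univ x)
      obtain ⟨w', rfl⟩ := hF hV
      rwa [huniq hx hxV]
    · obtain ⟨x, hx⟩ := hpt w hw
      have hx' : x ∈ C w' := hww' ▸ hx
      exact huniq hx hx'

lemma log_natCast_mono {a b : ℕ} (h : a ≤ b) : Real.log a ≤ Real.log b := by
  rcases Nat.eq_zero_or_pos a with rfl | ha
  · simpa using Real.log_natCast_nonneg b
  · exact Real.log_le_log (by exact_mod_cast ha) (by exact_mod_cast h)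

lemma upperRate_minSubcover_eq_zero (X : Subshift (Fin 2) ℤ) {β : ℝ} (hβ : 0 < β)
    (h : Tendsto (fun n : ℕ => Real.log ((words X n).ncard : ℝ) / (n : ℝ) ^ β) atTop (𝓝 0))
    {𝒰 : Set (Set X.carrier)} (h𝒰 : IsFiniteOpenCover 𝒰) :
    upperRate (fun n => minSubcover (iteratedCover (shiftMap X) 𝒰 n)) β = 0 := by
  obtain ⟨M, hM⟩ := exists_minSubcover_le X h𝒰
  apply upperRate_eq_zero
  -- The factor 2^β absorbs the longer words: n + 2M ≤ 2n once n > 2M.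
  have h1 := (h.comp (tendsto_add_atTop_nat (2 * M))).const_mul (2 ^ β)
  rw [mul_zero] at h1
  refine tendsto_of_tendsto_of_tendsto_of_le_of_le' tendsto_const_nhds h1
    (Eventually.of_forall fun n => div_nonneg (Real.log_natCast_nonneg _) (by positivity))
    (eventually_atTop.2 ⟨2 * M + 1, fun n hn => ?_⟩)
  have hn0 : (0 : ℝ) < n := by exact_mod_cast (show 0 < n by omega)
  have hle : ((n + 2 * M : ℕ) : ℝ) ≤ 2 * n := by exact_mod_cast (show n + 2 * M ≤ 2 * n by omega)
  have hpos : (0 : ℝ) < (n + 2 * M : ℕ) := by exact_mod_cast (show 0 < n + 2 * M by omega)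
  have h2 : ((n + 2 * M : ℕ) : ℝ) ^ β ≤ 2 ^ β * (n : ℝ) ^ β := by
    rw [← Real.mul_rpow (by norm_num) hn0.le]
    exact Real.rpow_le_rpow hpos.le hle hβ.le
  have h3 := log_natCast_mono (hM n)
  have h4 : 0 ≤ Real.log ((words X (n + 2 * M)).ncard : ℝ) := Real.log_natCast_nonneg _
  simp only [Function.comp_apply]
  rw [div_le_iff₀ (by positivity), mul_right_comm, ← mul_div_assoc, le_div_iff₀ (by positivity),
    mul_comm _ (Real.log _)]
  exact mul_le_mul h3 h2 (by positivity) h4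

/-- The entropy dimension of a subshift is the growth exponent of the number of its words. -/
theorem hasEntropyDim_of_words (X : Subshift (Fin 2) ℤ) {α : ℝ} (hα : 0 < α)
    (h0 : ∀ β : ℝ, α < β →
      Tendsto (fun n : ℕ => Real.log ((words X n).ncard : ℝ) / (n : ℝ) ^ β) atTop (𝓝 0))
    (h1 : ∀ β : ℝ, 0 < β → β < α →
      Tendsto (fun n : ℕ => Real.log ((words X n).ncard : ℝ) / (n : ℝ) ^ β) atTop atTop) :
    HasEntropyDim (shiftMap X) (ENNReal.ofReal α) := by
  have hupper : upperEntropyDim (shiftMap X) ≤ ENNReal.ofReal α := by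
    refine iSup₂_le fun 𝒰 h𝒰 => ?_
    -- Each β > α bounds the critical value, and β is sent to α from the right.
    refine ge_of_tendsto ((ENNReal.continuous_ofReal.tendsto α).mono_left
      (nhdsWithin_le_nhds (s := Ioi α))) ?_
    filter_upwards [self_mem_nhdsWithin] with β (hβ : α < β)
    exact iInf₂_le_of_le β (hα.trans hβ) (iInf_le_of_le
      (upperRate_minSubcover_eq_zero X (hα.trans hβ) (h0 β hβ) h𝒰) le_rfl)
  have hlower : ENNReal.ofReal α ≤ lowerEntropyDim (shiftMap X) := by
    refine le_iSup₂_of_le _ (isFiniteOpenCover_originCover X) ?_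
    refine le_iInf₂ fun β hβ => le_iInf fun hD => ENNReal.ofReal_le_ofReal ?_
    by_contra! hlt
    rw [lowerRate_eq_top] at hD
    · exact ENNReal.top_ne_zero hD
    · refine tendsto_atTop_mono (fun n => ?_) (h1 β hβ hlt)
      exact div_le_div_of_nonneg_right (log_natCast_mono (ncard_words_le_minSubcover X n))
        (by positivity)
  have hle := lowerEntropyDim_le_upperEntropyDim (shiftMap X)
  exact ⟨le_antisymm hupper (hlower.trans hle), le_antisymm (hle.trans hupper) hlower⟩

end EntropyDim
end

theorem mainTheorem1 (α : ℝ) (hα₀ : 0 < α) (hα₁ : α < 1) :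
    ∃ X : SymbolicDynamics.FullShift.Subshift (Fin 2) ℤ,
      EntropyDim.IsStrictlyErgodic (EntropyDim.shiftMap X) ∧
      EntropyDim.HasEntropyDim (EntropyDim.shiftMap X) (ENNReal.ofReal α) ∧
      (∀ β : ℝ, α < β →
        Tendsto (fun n : ℕ => Real.log ((EntropyDim.words X n).ncard : ℝ) / (n : ℝ) ^ β)
          atTop (𝓝 0)) ∧
      (∀ β : ℝ, 0 < β → β < α →
        Tendsto (fun n : ℕ => Real.log ((EntropyDim.words X n).ncard : ℝ) / (n : ℝ) ^ β)
          atTop atTop) := by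
  have hp : 1 < 1 / α := (one_lt_div hα₀).2 hα₁
  have h0 : ∀ β : ℝ, α < β → Tendsto (fun n : ℕ =>
      Real.log ((EntropyDim.words (EntropyDim.hierSubshift (1 / α)) n).ncard : ℝ) / (n : ℝ) ^ β)
      atTop (𝓝 0) := fun β hβ =>
    EntropyDim.tendsto_log_ncard_words_zero hp.le (by rwa [one_div_one_div])
  have h1 : ∀ β : ℝ, 0 < β → β < α → Tendsto (fun n : ℕ =>
      Real.log ((EntropyDim.words (EntropyDim.hierSubshift (1 / α)) n).ncard : ℝ) / (n : ℝ) ^ β)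
      atTop atTop := fun β hβ0 hβ =>
    EntropyDim.tendsto_log_ncard_words_atTop hp.le hβ0 (by rwa [one_div_one_div])
  exact ⟨EntropyDim.hierSubshift (1 / α),
    ⟨EntropyDim.isMinimalSystem_hierSubshift _, EntropyDim.isUniquelyErgodic_hierSubshift hp⟩,
    EntropyDim.hasEntropyDim_of_words _ hα₀ h0 h1, h0, h1⟩
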